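/- Let $T,s\ge 0$ be integers, let $N_0=K_0=0$, let $N_l,K_l\ge 0$ be integers, put $$M_l=\sum_{k=0}^{l}(N_k+K_k),\qquad S=\bigcup_{l=0}^{s-1}\{M_l+1,\dots,M_l+N_{l+1}\}\subset\mathbb Z,\qquad \rho=N_1+\dots+N_s .$$ Let $\vec\xi(j)=\{\xi_\nu(j)\}_{\nu=1}^T$ and $\vec\eta(j)=\{\eta_\nu(j)\}_{\nu=1}^T$, $j\in\mathbb Z$, be uncorrelated complex-valued $T$-variate (wide sense) stationary sequences with zero mean and finite second moments on a probability space, with spectral density matrices $f(\lambda)=f^{\vec\xi}(\lambda)$ and $g(\lambda)=f^{\vec\eta}(\lambda)$: these are integrable, nonnegative Hermitian for almost every $\lambda\in(-\pi,\pi]$, and $$\mathsf E\,\xi_\nu(n)\overline{\xi_\mu(m)}=\frac1{2\pi}\int_{-\pi}^{\pi}e^{i(n-m)\lambda}f_{\nu\mu}(\lambda)\,d\lambda ,$$ and similarly for $\vec\eta$ and $g$. Assume the minimality condition: $f(\lambda)+g(\lambda)$ is invertible for almost every $\lambda$ and $$\int_{-\pi}^{\pi}\operatorname{Tr}\big[(f(\lambda)+g(\lambda))^{-1}\big]\,d\lambda<\infty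 .$$ For given $\vec a(j)\in\mathbb C^T$ consider the optimal (minimal mean square error) linear estimate of $A_s\vec\xi=\sum_{j\in S}\vec a(j)^\top\vec\xi(j)$ from the observations $\vec\xi(j)+\vec\eta(j)$, $j\in\mathbb Z\setminus S$, that is, the minimizer of the mean square error over the closed linear span $H^-$ in $L^2$ of the variables $\xi_\nu(j)+\eta_\nu(j)$, $j\notin S$, $\nu=1,\dots,T$. Let $L_2(f+g)$ be the space of measurable $\vec b:(-\pi,\pi]\to\mathbb C^T$ with $\int \vec b^{\top}(f+g)\overline{\vec b}\,d\lambda<\infty$, and let $L_2^{s-}(f+g)$ be its closed subspace generated by the functions $e^{ij\lambda}\delta_\nu$, $j\notin S$, $\nu=1,\dots,T$, where $\delta_\nu$ is the $\nu$-th standard basis vector. Put $A_s(e^{i\lambda})=\sum_{j\in S}\vec a(j)e^{ij\lambda}$ and $$\Delta(\vec h;f,g)=\frac1{2\pi}\int_{-\pi}^{\pi}[A_s(e^{i\lambda})-\vec h(\lambda)]^\top f(\lambda)\overline{[A_s(e^{i\lambda})-\vec h(\lambda)]}\,d\lambda+\frac1{2\pi}\int_{-\pi}^{\pi}\vec h(\lambda)^\top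 g(\lambda)\overline{\vec h(\lambda)}\,d\lambda .$$ Let $\mathbf B_s,\mathbf D_s,\mathbf R_s$ be the $T\rho\times T\rho$ matrices whose $T\times T$ blocks, for $k,j\in S$, are $$B(k,j)=\frac1{2\pi}\int_{-\pi}^{\pi}\big[(f+g)^{-1}\big]^\top e^{i(j-k)\lambda}d\lambda,\qquad D(k,j)=\frac1{2\pi}\int_{-\pi}^{\pi}\big[f(f+g)^{-1}\big]^\top e^{i(j-k)\lambda}d\lambda,$$ $$R(k,j)=\frac1{2\pi}\int_{-\pi}^{\pi}\big[f(f+g)^{-1}g\big]^\top e^{i(j-k)\lambda}d\lambda .$$ Let $\vec a_s\in\mathbb C^{T\rho}$ be the column vector of the $\vec a(j)$, $j\in S$. Then these integrals converge absolutely and $\mathbf B_s$ is invertible. With $\vec c_s=\{\vec c(k)\}_{k\in S}=\mathbf B_s^{-1}\mathbf D_s\vec a_s$ and $C_s(e^{i\lambda})=\sum_{k\in S}\vec c(k)e^{ik\lambda}$, the function $$\vec h^\top=\big(A_s^\top(e^{i\lambda})f(\lambda)-C_s^\top(e^{i\lambda})\big)[f(\lambda)+g(\lambda)]^{-1}=A_s^\top(e^{i\lambda})-\big(A_s^\top(e^{i\lambda})g(\lambda)+C_s^\top(e^{i\lambda})\big)[f(\lambda)+g(\lambda)]^{-1}$$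 (the two expressions agree for almost every $\lambda$) belongs to $L_2^{s-}(f+g)$ and is, up to almost everywhere equality, the unique minimizer of $\Delta(\cdot;f,g)$ over $L_2^{s-}(f+g)$. The optimal linear estimate $\widehat{A_s\vec\xi}$ exists and is unique almost surely, $\vec h$ is its spectral characteristic, i.e. $$\widehat{A_s\vec\xi}=\int_{-\pi}^{\pi}\vec h^\top(\lambda)\,\big(Z^{\vec\xi}(d\lambda)+Z^{\vec\eta}(d\lambda)\big),$$ where $Z^{\vec\xi},Z^{\vec\eta}$ are the orthogonal random measures of $\vec\xi$ and $\vec\eta$ (so that $\xi_\nu(j)=\int e^{ij\lambda}Z^{\vec\xi}_\nu(d\lambda)$ with $\mathsf E Z^{\vec\xi}_\nu(\Delta)\overline{Z^{\vec\xi}_\mu(\Delta')}=\frac1{2\pi}\int_{\Delta\cap\Delta'}f_{\nu\mu}\,d\lambda$, and similarly for $\vec\eta$ with $g$), and its mean square error is $$\mathsf E\big|A_s\vec\xi-\widehat{A_s\vec\xi}\big|^2=\Delta(\vec h;f,g)=\langle\vec a_s,\mathbf R_s\vec a_s\rangle+\langle\vec c_s,\mathbf B_s\vec c_s\rangle ,$$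 where $\langle u,v\rangle=\sum_k u_k\overline{v_k}$. -/

import Mathlib

open MeasureTheory Filter Topology
open scoped ENNReal ComplexConjugate ComplexOrder

noncomputable section

namespace Interp

/-! ### Stationary sequences and their spectral densities -/

section Sequences

variable {Ω : Type*} [MeasurableSpace Ω]

/-- A `T`-variate complex stochastic sequence `ξ j ω ν` with zero mean and finite second moments
whose covariances `E ξ_ν(n) conj (ξ_μ(m))` depend on `n - m` only. -/
structure IsStationary (P : Measure Ω) {T : ℕ} (ξ : ℤ → Ω → Fin T → ℂ) : Prop where
  memLp : ∀ n ν, MemLp (fun ω => ξ n ω ν) 2 P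
  mean_zero : ∀ n ν, ∫ ω, ξ n ω ν ∂P = 0
  cov_shift : ∀ n m k ν μ,
    ∫ ω, ξ (n + k) ω ν * conj (ξ (m + k) ω μ) ∂P = ∫ ω, ξ n ω ν * conj (ξ m ω μ) ∂P

/-- `E ξ_ν(n) conj (η_μ(m)) = 0` for all times and components. -/
def Uncorrelated (P : Measure Ω) {T : ℕ} (ξ η : ℤ → Ω → Fin T → ℂ) : Prop :=
  ∀ n m ν μ, ∫ ω, ξ n ω ν * conj (η m ω μ) ∂P = 0

/-- Lebesgue measure on the frequency interval `(-π, π]`. -/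
def freq : Measure ℝ := volume.restrict (Set.Ioc (-Real.pi) Real.pi)

/-- `f` is a spectral density matrix of `ξ`: a nonnegative Hermitian integrable matrix function
with `E ξ_ν(n) conj (ξ_μ(m)) = (2π)⁻¹ ∫ e^{i(n-m)λ} f_{νμ}(λ) dλ`. -/
structure IsSpectralDensity (P : Measure Ω) {T : ℕ} (ξ : ℤ → Ω → Fin T → ℂ)
    (f : ℝ → Matrix (Fin T) (Fin T) ℂ) : Prop where
  integrable : ∀ ν μ, Integrable (fun x => f x ν μ) freq
  posSemidef : ∀ᵐ x ∂freq, (f x).PosSemidef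
  covariance : ∀ n m ν μ, ∫ ω, ξ n ω ν * conj (ξ m ω μ) ∂P =
    (1 / (2 * Real.pi) : ℂ) *
      ∫ x, Complex.exp (Complex.I * ((n - m : ℤ) : ℂ) * (x : ℂ)) * f x ν μ ∂freq

end Sequences

/-- The minimality condition `∫ Tr [F(λ)⁻¹] dλ < ∞`, which includes that `F(λ)` is invertible
for almost every `λ`. -/
def Minimality {T : ℕ} (F : ℝ → Matrix (Fin T) (Fin T) ℂ) : Prop :=
  (∀ᵐ x ∂freq, IsUnit (F x).det) ∧ Integrable (fun x => ((F x)⁻¹).trace) freq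

/-! ### The space `L₂(f)` and its subspace `L₂^{s-}(f)` -/

/-- `bᵀ(λ) f(λ) conj (b(λ))`, real and nonnegative where `f(λ)` is positive semidefinite. -/
def quadForm {T : ℕ} (f : ℝ → Matrix (Fin T) (Fin T) ℂ) (b : ℝ → Fin T → ℂ) (x : ℝ) : ℝ :=
  (∑ ν, ∑ μ, b x ν * f x ν μ * conj (b x μ)).re

/-- Membership in `L₂(f)`. -/
def MemL2 {T : ℕ} (f : ℝ → Matrix (Fin T) (Fin T) ℂ) (b : ℝ → Fin T → ℂ) : Prop :=
  AEStronglyMeasurable b freq ∧ Integrable (quadForm f b) freq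

/-- `e^{ijλ}`. -/
def expo (j : ℤ) (x : ℝ) : ℂ := Complex.exp (Complex.I * (j : ℂ) * (x : ℂ))

/-- The vector trigonometric polynomial `∑ⱼ p(j) e^{ijλ}`. -/
def trigPoly {T : ℕ} (p : ℤ →₀ (Fin T → ℂ)) (x : ℝ) : Fin T → ℂ :=
  ∑ j ∈ p.support, expo j x • p j

/-- Membership in the closed subspace of `L₂(f)` generated by the functions `e^{ijλ} δ_ν`,
`j ∉ S`, `ν = 1, …, T`. -/
def MemL2Minus {T : ℕ} (f : ℝ → Matrix (Fin T) (Fin T) ℂ) (S : Set ℤ)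
    (h : ℝ → Fin T → ℂ) : Prop :=
  MemL2 f h ∧ ∀ ε : ℝ, 0 < ε → ∃ p : ℤ →₀ (Fin T → ℂ), (∀ j ∈ p.support, j ∉ S) ∧
    ∫ x, quadForm f (fun x => h x - trigPoly p x) x ∂freq < ε

/-- The mean square error functional
`Δ(h; f, g) = (2π)⁻¹ ∫ [A - h]ᵀ f conj [A - h] dλ + (2π)⁻¹ ∫ hᵀ g conj h dλ`. -/
def spectralMSE {T : ℕ} (f g : ℝ → Matrix (Fin T) (Fin T) ℂ) (A h : ℝ → Fin T → ℂ) : ℝ :=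
  1 / (2 * Real.pi) * ∫ x, quadForm f (fun x => A x - h x) x ∂freq +
  1 / (2 * Real.pi) * ∫ x, quadForm g h x ∂freq

/-- `h` is a minimizer of `Δ(·; f, g)` over `L₂^{s-}(f + g)`. -/
def IsOptimalCharacteristic {T : ℕ} (f g : ℝ → Matrix (Fin T) (Fin T) ℂ) (S : Set ℤ)
    (A h : ℝ → Fin T → ℂ) : Prop :=
  MemL2Minus (fun x => f x + g x) S h ∧
    ∀ h', MemL2Minus (fun x => f x + g x) S h' → spectralMSE f g A h ≤ spectralMSE f g A h'

/-! ### Random measures and stochastic integrals -/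

section RandomMeasure

variable {Ω : Type*} [MeasurableSpace Ω]

/-- `∫ φᵀ(λ) Z(dλ)` over `(-π, π]` for a simple function `φ`. -/
def simpleIntegral {T : ℕ} (Z : Set ℝ → Ω → Fin T → ℂ) (φ : SimpleFunc ℝ (Fin T → ℂ))
    (ω : Ω) : ℂ :=
  ∑ v ∈ φ.range, ∑ ν, v ν * Z (φ ⁻¹' {v} ∩ Set.Ioc (-Real.pi) Real.pi) ω ν

/-- `X = ∫ hᵀ(λ) Z(dλ)`, for a random measure `Z` whose structure measure has the density `f`:
`h` belongs to `L₂(f)` and `X` is the mean square limit of the integrals of simple functions that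
converge to `h` in `L₂(f)`. -/
def IsStochasticIntegral (P : Measure Ω) {T : ℕ} (f : ℝ → Matrix (Fin T) (Fin T) ℂ)
    (Z : Set ℝ → Ω → Fin T → ℂ) (h : ℝ → Fin T → ℂ) (X : Ω → ℂ) : Prop :=
  MemL2 f h ∧ MemLp X 2 P ∧ ∃ φ : ℕ → SimpleFunc ℝ (Fin T → ℂ),
    Tendsto (fun n => ∫ x, quadForm f (fun x => h x - φ n x) x ∂freq) atTop (𝓝 0) ∧
    Tendsto (fun n => eLpNorm (fun ω => X ω - simpleIntegral Z (φ n) ω) 2 P) atTop (𝓝 0)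

/-- `Z` is the orthogonal random measure of the sequence `ξ` with spectral density `f`:
`E Z_ν(Δ) conj (Z_μ(Δ')) = (2π)⁻¹ ∫_{Δ ∩ Δ'} f_{νμ}(λ) dλ` and `ξ_ν(j) = ∫ e^{ijλ} Z_ν(dλ)`. -/
structure IsRandomSpectralMeasure (P : Measure Ω) {T : ℕ} (ξ : ℤ → Ω → Fin T → ℂ)
    (f : ℝ → Matrix (Fin T) (Fin T) ℂ) (Z : Set ℝ → Ω → Fin T → ℂ) : Prop where
  memLp : ∀ Δ, MeasurableSet Δ → Δ ⊆ Set.Ioc (-Real.pi) Real.pi →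
    ∀ ν, MemLp (fun ω => Z Δ ω ν) 2 P
  mean_zero : ∀ Δ, MeasurableSet Δ → Δ ⊆ Set.Ioc (-Real.pi) Real.pi →
    ∀ ν, ∫ ω, Z Δ ω ν ∂P = 0
  additive : ∀ Δ Δ', MeasurableSet Δ → Δ ⊆ Set.Ioc (-Real.pi) Real.pi →
    MeasurableSet Δ' → Δ' ⊆ Set.Ioc (-Real.pi) Real.pi → Disjoint Δ Δ' →
    Z (Δ ∪ Δ') =ᵐ[P] fun ω => Z Δ ω + Z Δ' ω
  orthogonal : ∀ Δ Δ', MeasurableSet Δ → Δ ⊆ Set.Ioc (-Real.pi) Real.pi →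
    MeasurableSet Δ' → Δ' ⊆ Set.Ioc (-Real.pi) Real.pi → ∀ ν μ,
    ∫ ω, Z Δ ω ν * conj (Z Δ' ω μ) ∂P =
      (1 / (2 * Real.pi) : ℂ) * ∫ x in Δ ∩ Δ', f x ν μ
  representation : ∀ j ν,
    IsStochasticIntegral P f Z (fun x => Pi.single ν (expo j x)) (fun ω => ξ j ω ν)

end RandomMeasure

/-! ### Linear estimates -/

section Estimates

variable {Ω : Type*} [MeasurableSpace Ω]

/-- The closed subspace of `L²(P)` generated by the values `ζ_ν(j)`, `j ∉ S`, `ν = 1, …, T`. -/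
def observed (P : Measure Ω) {T : ℕ} (ζ : ℤ → Ω → Fin T → ℂ) (S : Set ℤ) :
    Submodule ℂ (Lp ℂ 2 P) :=
  (Submodule.span ℂ {X : Lp ℂ 2 P | ∃ j, j ∉ S ∧ ∃ ν, X =ᵐ[P] fun ω => ζ j ω ν}).topologicalClosure

/-- `X` is an optimal linear estimate of the random variable `A` from the observations `ζ(j)`,
`j ∉ S`: it minimizes the mean square error among all linear estimates. -/
def IsOptimalLinearEstimate (P : Measure Ω) {T : ℕ} (ζ : ℤ → Ω → Fin T → ℂ) (S : Set ℤ)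
    (A : Ω → ℂ) (X : Lp ℂ 2 P) : Prop :=
  X ∈ observed P ζ S ∧
    ∀ Y ∈ observed P ζ S, ∫ ω, ‖A ω - X ω‖ ^ 2 ∂P ≤ ∫ ω, ‖A ω - Y ω‖ ^ 2 ∂P

end Estimates

/-! ### The set of missing observations and the block matrices -/

/-- `M_l = ∑_{k=0}^{l} (N_k + K_k)`. -/
def blockStart (N K : ℕ → ℕ) (l : ℕ) : ℕ := ∑ k ∈ Finset.range (l + 1), (N k + K k)

/-- `S = ⋃_{l=0}^{s-1} {M_l + 1, …, M_l + N_{l+1}}`. -/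
def missing (N K : ℕ → ℕ) (s : ℕ) : Set ℤ :=
  ⋃ l ∈ Finset.range s,
    Set.Icc ((blockStart N K l : ℤ) + 1) ((blockStart N K l : ℤ) + (N (l + 1) : ℤ))

/-- Positions in the blocks: `⟨l, i⟩` is the `i`-th (counted from `0`) position of block `l`. -/
abbrev Pos (N : ℕ → ℕ) (s : ℕ) : Type := Σ l : Fin s, Fin (N ((l : ℕ) + 1))

/-- The time point `M_l + 1 + i` of the position `⟨l, i⟩`. -/
def time (N K : ℕ → ℕ) {s : ℕ} (k : Pos N s) : ℤ :=
  (blockStart N K (k.1 : ℕ) : ℤ) + 1 + ((k.2 : ℕ) : ℤ)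

/-- The `Tρ × Tρ` matrix, `ρ = N_1 + … + N_s`, whose `T × T` block at the times `k, j` of `S` is
`(2π)⁻¹ ∫ [G(λ)]ᵀ e^{i(j-k)λ} dλ`. -/
def blockToeplitz (N K : ℕ → ℕ) (s : ℕ) {T : ℕ} (G : ℝ → Matrix (Fin T) (Fin T) ℂ) :
    Matrix (Pos N s × Fin T) (Pos N s × Fin T) ℂ :=
  Matrix.of fun k j => (1 / (2 * Real.pi) : ℂ) *
    ∫ x, (G x).transpose k.2 j.2 * expo (time N K j.1 - time N K k.1) x ∂freq

/-- The symbol `[f + g]⁻¹` of `B_s`. -/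
def symbolB {T : ℕ} (f g : ℝ → Matrix (Fin T) (Fin T) ℂ) (x : ℝ) : Matrix (Fin T) (Fin T) ℂ :=
  (f x + g x)⁻¹

/-- The symbol `f [f + g]⁻¹` of `D_s`. -/
def symbolD {T : ℕ} (f g : ℝ → Matrix (Fin T) (Fin T) ℂ) (x : ℝ) : Matrix (Fin T) (Fin T) ℂ :=
  f x * (f x + g x)⁻¹

/-- The symbol `f [f + g]⁻¹ g` of `R_s`. -/
def symbolR {T : ℕ} (f g : ℝ → Matrix (Fin T) (Fin T) ℂ) (x : ℝ) : Matrix (Fin T) (Fin T) ℂ :=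
  f x * (f x + g x)⁻¹ * g x

/-- The functional `A_s ξ = ∑_{l} ∑_{j = M_l + 1}^{M_l + N_{l+1}} aᵀ(j) ξ(j)`. -/
def functional {Ω : Type*} (N K : ℕ → ℕ) (s : ℕ) {T : ℕ} (a : ℤ → Fin T → ℂ)
    (ξ : ℤ → Ω → Fin T → ℂ) (ω : Ω) : ℂ :=
  ∑ l ∈ Finset.range s,
    ∑ j ∈ Finset.Icc ((blockStart N K l : ℤ) + 1) ((blockStart N K l : ℤ) + (N (l + 1) : ℤ)),
      ∑ ν, a j ν * ξ j ω ν

/-- The column vector of the values of `a` on `S`. -/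
def coeffVec (N K : ℕ → ℕ) (s : ℕ) {T : ℕ} (a : ℤ → Fin T → ℂ) : Pos N s × Fin T → ℂ :=
  fun k => a (time N K k.1) k.2

/-- The vector polynomial `∑_{k ∈ S} v(k) e^{ikλ}` of a column vector `v`. -/
def vecPoly (N K : ℕ → ℕ) (s : ℕ) {T : ℕ} (v : Pos N s × Fin T → ℂ) (x : ℝ) : Fin T → ℂ :=
  fun ν => ∑ k : Pos N s, v (k, ν) * expo (time N K k) x

/-- The vector `c_s = B_s⁻¹ D_s a_s`. -/
def solVec (N K : ℕ → ℕ) (s : ℕ) {T : ℕ} (f g : ℝ → Matrix (Fin T) (Fin T) ℂ)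
    (a : ℤ → Fin T → ℂ) : Pos N s × Fin T → ℂ :=
  (blockToeplitz N K s (symbolB f g))⁻¹.mulVec
    ((blockToeplitz N K s (symbolD f g)).mulVec (coeffVec N K s a))

/-- `hᵀ = (A_sᵀ f - C_sᵀ) [f + g]⁻¹`. -/
def optChar (N K : ℕ → ℕ) (s : ℕ) {T : ℕ} (f g : ℝ → Matrix (Fin T) (Fin T) ℂ)
    (a : ℤ → Fin T → ℂ) (x : ℝ) : Fin T → ℂ :=
  Matrix.vecMul
    (Matrix.vecMul (vecPoly N K s (coeffVec N K s a) x) (f x)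
      - vecPoly N K s (solVec N K s f g a) x)
    (f x + g x)⁻¹

/-- The scalar product `⟨u, v⟩ = ∑ₖ u(k) conj (v(k))`. -/
def scalarProd {ι : Type*} [Fintype ι] (u v : ι → ℂ) : ℂ := ∑ k, u k * conj (v k)

/-- `⟨a_s, R_s a_s⟩ + ⟨c_s, B_s c_s⟩`. -/
def errorValue (N K : ℕ → ℕ) (s : ℕ) {T : ℕ} (f g : ℝ → Matrix (Fin T) (Fin T) ℂ)
    (a : ℤ → Fin T → ℂ) : ℂ :=
  scalarProd (coeffVec N K s a)
      ((blockToeplitz N K s (symbolR f g)).mulVec (coeffVec N K s a)) +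
    scalarProd (solVec N K s f g a)
      ((blockToeplitz N K s (symbolB f g)).mulVec (solVec N K s f g a))

end Interp

end

/-! Write `F = f + g`. The estimate is an orthogonal projection, and the proof solves its normal
equations in the frequency domain, then transfers the answer to `L²(P)`.

Since `F⁻¹` is integrable, for a bounded vector function `p` the integral of `h ⬝ᵥ star p` is the
inner product in `L₂(F)` of `h` with `p F⁻¹`. So Fourier coefficients are bounded functionals on
`L₂(F)`, and `L₂^{s-}(F)` consists exactly of the elements whose coefficients vanish on `S`
(`MemL2Minus.integral_mul_expo_eq_zero` and its converse `memL2Minus_of_integral_mul_expo_eq_zero`).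
The converse is a bi-orthogonality argument: a vector orthogonal to all generators produces
integrable functions with finitely many nonzero Fourier coefficients, hence trigonometric
polynomials.

The characteristic `h` satisfies `h F = A f - C`. The equation `B c = D a` says that the
coefficients of `h` on `S` vanish, so `h` lies in the subspace. As `C` has frequencies in `S`, it is
orthogonal to the subspace, and completing the square gives `Δ(d) = Δ(h) + ‖d - h‖²`, the last norm
being that of `L₂(F)` with the factor `1/(2π)` (`spectralMSE_eq_add`). Optimality and uniqueness
follow. The value of the minimum is a pointwise matrix identity (`sform_optimal`), and `B` is
invertible because its quadratic form is the integral of a positive definite form.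

For a finite linear estimate with coefficients `p`, the probabilistic error equals `Δ` of the
polynomial of `p`, because `ξ` and `η` are uncorrelated. Comparing this with Pythagoras in `L²(P)`
shows that the projection `X` has error `Δ(h)`, and that its distance to that estimate is the
`L₂(F)` distance from `h` to the polynomial (`exists_projection`). Polynomials tending to `h`
therefore give estimates tending to `X`. With the isometry of integrals of simple functions this
identifies `X` as the stochastic integral of `h`; the correlation between the two random measures
never enters. -/

namespace Interp

/-! ### Sesquilinear forms of positive semidefinite matrices -/

section Forms

variable {n : Type*} [Fintype n]

/-- The sesquilinear form `uᵀ M conj v`. -/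
def sform (M : Matrix n n ℂ) (u v : n → ℂ) : ℂ := u ⬝ᵥ (M.mulVec (star v))

theorem sform_add_left (M : Matrix n n ℂ) (u v w : n → ℂ) :
    sform M (u + v) w = sform M u w + sform M v w := by simp [sform]

theorem sform_sub_left (M : Matrix n n ℂ) (u v w : n → ℂ) :
    sform M (u - v) w = sform M u w - sform M v w := by simp [sform]

theorem sform_smul_left (M : Matrix n n ℂ) (c : ℂ) (u w : n → ℂ) :
    sform M (c • u) w = c * sform M u w := by simp [sform]

theorem sform_add_right (M : Matrix n n ℂ) (u v w : n → ℂ) :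
    sform M w (u + v) = sform M w u + sform M w v := by simp [sform, Matrix.mulVec_add]

theorem sform_sub_right (M : Matrix n n ℂ) (u v w : n → ℂ) :
    sform M w (u - v) = sform M w u - sform M w v := by simp [sform, Matrix.mulVec_sub]

theorem sform_smul_right (M : Matrix n n ℂ) (c : ℂ) (u w : n → ℂ) :
    sform M w (c • u) = conj c * sform M w u := by simp [sform, Matrix.mulVec_smul]

theorem sform_add_matrix (M M' : Matrix n n ℂ) (u w : n → ℂ) :
    sform (M + M') u w = sform M u w + sform M' u w := by simp [sform, Matrix.add_mulVec]

theorem sform_eq_sum (M : Matrix n n ℂ) (u v : n → ℂ) :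
    sform M u v = ∑ ν, ∑ μ, u ν * M ν μ * conj (v μ) := by
  simp only [sform, dotProduct, Matrix.mulVec, Finset.mul_sum, mul_assoc]
  rfl

theorem sform_single [DecidableEq n] (M : Matrix n n ℂ) (ν μ : n) :
    sform M (Pi.single ν 1) (Pi.single μ 1) = M ν μ := by
  simp [sform]

theorem conj_sform {M : Matrix n n ℂ} (hM : M.IsHermitian) (u v : n → ℂ) :
    conj (sform M u v) = sform M v u := by
  rw [sform_eq_sum, sform_eq_sum]
  simp only [map_sum]
  rw [Finset.sum_comm]
  refine Finset.sum_congr rfl fun ν _ => Finset.sum_congr rfl fun μ _ => ?_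
  have : conj (M μ ν) = M ν μ := hM.apply ν μ
  rw [map_mul, map_mul, this, Complex.conj_conj]
  ring

theorem sform_self_nonneg {M : Matrix n n ℂ} (hM : M.PosSemidef) (u : n → ℂ) :
    0 ≤ (sform M u u).re := by
  have := hM.dotProduct_mulVec_nonneg (star u)
  rw [star_star] at this
  exact (Complex.le_def.1 this).1

theorem sform_self_eq_re {M : Matrix n n ℂ} (hM : M.PosSemidef) (u : n → ℂ) :
    sform M u u = ((sform M u u).re : ℂ) := by
  exact (Complex.conj_eq_iff_re.1 (conj_sform hM.1 u u)).symm

/-- Cauchy-Schwarz combined with the inequality of arithmetic and geometric means: rotate `u` by a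
phase `c` that makes the form real, then expand the form at `c • u - v`. The additive shape yields
integrable dominating functions directly. -/
theorem norm_sform_le {M : Matrix n n ℂ} (hM : M.PosSemidef) (u v : n → ℂ) :
    ‖sform M u v‖ ≤ ((sform M u u).re + (sform M v v).re) / 2 := by
  obtain ⟨c, hc, hcs⟩ : ∃ c : ℂ, ‖c‖ = 1 ∧ c * sform M u v = ‖sform M u v‖ := by
    by_cases h : sform M u v = 0
    · exact ⟨1, by simp, by simp [h]⟩
    · refine ⟨‖sform M u v‖ / sform M u v, ?_, by field_simp⟩
      simp [h]
  have hcc : c * conj c = 1 := by rw [Complex.mul_conj, Complex.normSq_eq_norm_sq, hc]; simp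
  have h1 : sform M (c • u - v) (c • u - v) =
      sform M u u + sform M v v - 2 * ‖sform M u v‖ := by
    have h2 : conj c * sform M v u = ‖sform M u v‖ := by
      rw [← conj_sform hM.1 u v, ← map_mul, hcs, Complex.conj_ofReal]
    simp only [sform_sub_left, sform_sub_right, sform_smul_left, sform_smul_right, hcs]
    linear_combination sform M u u * hcc - h2
  have h3 := sform_self_nonneg hM (c • u - v)
  rw [h1] at h3
  simp at h3
  linarith

theorem sform_self_add_le {M : Matrix n n ℂ} (hM : M.PosSemidef) (u v : n → ℂ) :
    (sform M (u + v) (u + v)).re ≤ 2 * (sform M u u).re + 2 * (sform M v v).re := by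
  have h1 := sform_self_nonneg hM (u - v)
  simp only [sform_sub_left, sform_sub_right, sform_add_left, sform_add_right, Complex.add_re,
    Complex.sub_re] at h1 ⊢
  linarith

theorem sform_self_sub_le {M : Matrix n n ℂ} (hM : M.PosSemidef) (u v : n → ℂ) :
    (sform M (u - v) (u - v)).re ≤ 2 * (sform M u u).re + 2 * (sform M v v).re := by
  have h1 := sform_self_nonneg hM (u + v)
  simp only [sform_sub_left, sform_sub_right, sform_add_left, sform_add_right, Complex.add_re,
    Complex.sub_re] at h1 ⊢
  linarith

end Forms

theorem quadForm_eq {T : ℕ} (f : ℝ → Matrix (Fin T) (Fin T) ℂ) (b : ℝ → Fin T → ℂ) (x : ℝ) :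
    quadForm f b x = (sform (f x) (b x) (b x)).re := by
  rw [sform_eq_sum]; rfl

/-! ### Measurable factorization of positive semidefinite matrix functions -/

open scoped Matrix.Norms.L2Operator MatrixOrder in
theorem continuous_sqrt_comp {n : Type*} [Fintype n] [DecidableEq n] {X : Type*}
    [TopologicalSpace X] {a : X → Matrix n n ℂ} (ha : Continuous a) (h : ∀ x, (a x).PosSemidef) :
    Continuous fun x => CFC.sqrt (a x) := by
  simp_rw [CFC.sqrt_eq_cfc]
  exact Continuous.cfc_nnreal_of_mem_nhdsSet (s := Set.univ) _ (by simp) ha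
    (fun x => (h x).nonneg) (by fun_prop)

-- `Q M` is the square root of `|M| = sqrt (Mᴴ M)`. Passing through `|M|`, which equals `M` on
-- positive semidefinite matrices, makes `Q` continuous on the whole matrix space, so measurability
-- survives composition.
open scoped Matrix.Norms.L2Operator MatrixOrder in
theorem exists_continuous_factor (n : Type*) [Fintype n] [DecidableEq n] :
    ∃ Q : Matrix n n ℂ → Matrix n n ℂ, Continuous Q ∧
      ∀ M, M.PosSemidef → (Q M).conjTranspose * Q M = M := by
  have h1 : ∀ M : Matrix n n ℂ, (M.conjTranspose * M).PosSemidef :=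
    fun M => Matrix.posSemidef_conjTranspose_mul_self M
  have c1 := continuous_sqrt_comp (n := n) (X := Matrix n n ℂ)
    (a := fun M => M.conjTranspose * M) (by fun_prop) h1
  refine ⟨_, continuous_sqrt_comp c1 fun M => Matrix.nonneg_iff_posSemidef.1 (CFC.sqrt_nonneg _), fun M hM => ?_⟩
  have h2 : CFC.sqrt (M.conjTranspose * M) = M := by
    rw [hM.1]
    exact CFC.sqrt_mul_self M hM.nonneg
  simp only [h2]
  have h3 : (CFC.sqrt M).conjTranspose = CFC.sqrt M := (Matrix.nonneg_iff_posSemidef.1 (CFC.sqrt_nonneg M)).1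
  rw [h3]
  exact CFC.sqrt_mul_sqrt_self M hM.nonneg

/-- The transpose is factored because the forms here are `bᵀ f conj b`: this makes `‖Q b‖²` equal to
that form, so `b ↦ Q b` is an isometry into an unweighted `L²`. -/
theorem exists_measurable_factor {α : Type*} [MeasurableSpace α] {m : Measure α} {n : Type*}
    [Fintype n] {f : α → Matrix n n ℂ} (hf : AEStronglyMeasurable f m)
    (hpos : ∀ᵐ x ∂m, (f x).PosSemidef) :
    ∃ Q : α → Matrix n n ℂ, AEStronglyMeasurable Q m ∧
      ∀ᵐ x ∂m, (Q x).conjTranspose * Q x = (f x).transpose := by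
  classical
  obtain ⟨Q, hQ, hQM⟩ := exists_continuous_factor n
  refine ⟨fun x => Q (f x).transpose, ?_, ?_⟩
  · exact (hQ.comp (continuous_id.matrix_transpose)).comp_aestronglyMeasurable hf
  · filter_upwards [hpos] with x hx using hQM _ hx.transpose

/-! ### Trigonometric functions and Fourier coefficients on `(-π, π]` -/

instance : IsFiniteMeasure freq := by unfold freq; infer_instance

theorem continuous_expo (j : ℤ) : Continuous (expo j) := by unfold expo; fun_prop

theorem expo_add (j k : ℤ) (x : ℝ) : expo (j + k) x = expo j x * expo k x := by
  simp only [expo, ← Complex.exp_add]; push_cast; ring_nf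

theorem expo_zero (x : ℝ) : expo 0 x = 1 := by simp [expo]

theorem conj_expo (j : ℤ) (x : ℝ) : conj (expo j x) = expo (-j) x := by
  simp only [expo, ← Complex.exp_conj]; simp

theorem norm_expo (j : ℤ) (x : ℝ) : ‖expo j x‖ = 1 := by
  have := Complex.norm_exp_ofReal_mul_I (j * x)
  rw [← this, expo]; push_cast; ring_nf

theorem expo_eq_fourier [Fact (0 < 2 * Real.pi)] (j : ℤ) (x : ℝ) :
    fourier (T := 2 * Real.pi) j (x : AddCircle (2 * Real.pi)) = expo j x := by
  rw [fourier_coe_apply, expo]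
  congr 1
  have : (Real.pi : ℂ) ≠ 0 := by exact_mod_cast Real.pi_ne_zero
  push_cast
  field_simp

theorem integral_expo (j : ℤ) : ∫ x, expo j x ∂freq = if j = 0 then (2 * Real.pi : ℂ) else 0 := by
  rw [freq, ← intervalIntegral.integral_of_le (by linarith [Real.pi_pos])]
  split_ifs with h
  · subst h
    simp only [expo_zero]
    rw [intervalIntegral.integral_const]
    simp; ring
  · have hc : Complex.I * (j : ℂ) ≠ 0 := by simp [h]
    simp only [expo]
    rw [integral_exp_mul_complex hc]
    have : Complex.exp (Complex.I * j * (Real.pi : ℝ)) =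
        Complex.exp (Complex.I * j * ((-Real.pi : ℝ) : ℂ)) := by
      rw [Complex.exp_eq_exp_iff_exists_int]
      exact ⟨j, by push_cast; ring⟩
    rw [this]; simp

theorem integrable_mul_expo {u : ℝ → ℂ} (hu : Integrable u freq) (j : ℤ) :
    Integrable (fun x => u x * expo j x) freq :=
  hu.mul_bdd (c := 1) (continuous_expo j).aestronglyMeasurable (ae_of_all _ fun x => (norm_expo j x).le)

/-- An integrable function whose Fourier coefficients vanish is zero almost everywhere. -/
theorem ae_eq_zero_of_integral_mul_expo {u : ℝ → ℂ} (hu : Integrable u freq)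
    (h : ∀ j : ℤ, ∫ x, u x * expo j x ∂freq = 0) : u =ᵐ[freq] 0 := by
  have : Fact (0 < 2 * Real.pi) := ⟨by positivity⟩
  -- Integration against `u` is continuous in the sup norm, and the characters on which it vanishes
  -- span a dense subspace.
  have hcirc : ∀ φ : C(AddCircle (2 * Real.pi), ℂ), ∫ x, u x * φ (x : ℝ) ∂freq = 0 := by
    have hint : ∀ φ : C(AddCircle (2 * Real.pi), ℂ),
        Integrable (fun x : ℝ => u x * φ (x : ℝ)) freq := fun φ =>
      hu.mul_bdd (c := ‖φ‖) (φ.continuous.comp (AddCircle.continuous_mk' _)).aestronglyMeasurable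
        (ae_of_all _ fun x => φ.norm_coe_le_norm _)
    let L : C(AddCircle (2 * Real.pi), ℂ) →L[ℂ] ℂ := LinearMap.mkContinuous
      { toFun := fun φ => ∫ x, u x * φ (x : ℝ) ∂freq
        map_add' := fun φ ψ => by
          rw [← integral_add (hint φ) (hint ψ)]; simp [mul_add]
        map_smul' := fun c φ => by
          rw [RingHom.id_apply, smul_eq_mul, ← integral_const_mul]
          congr 1; ext x; simp; ring }
      (∫ x, ‖u x‖ ∂freq) (fun φ => by
        refine (norm_integral_le_integral_norm _).trans ?_
        rw [← integral_mul_const]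
        refine integral_mono (hint φ).norm (hu.norm.mul_const _) fun x => ?_
        simp only [norm_mul]
        exact mul_le_mul_of_nonneg_left (φ.norm_coe_le_norm _) (norm_nonneg _))
    have hle : Submodule.span ℂ (Set.range (@fourier (2 * Real.pi))) ≤ L.ker := by
      rw [Submodule.span_le]
      rintro _ ⟨j, rfl⟩
      change ∫ x, u x * fourier j ((x : ℝ) : AddCircle (2 * Real.pi)) ∂freq = 0
      simp only [expo_eq_fourier]
      exact h j
    have htop := Submodule.topologicalClosure_minimal _ hle L.isClosed_ker
    rw [span_fourier_closure_eq_top] at htop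
    exact fun φ => htop (Submodule.mem_top (x := φ))
  -- A test function supported in the open interval vanishes at both endpoints, so it descends to a
  -- continuous function on the circle.
  have hIoo : ∀ᵐ x, x ∈ Set.Ioo (-Real.pi) Real.pi → u x = 0 := by
    refine isOpen_Ioo.ae_eq_zero_of_integral_contDiff_smul_eq_zero ?_ fun φ hφ _ hsub => ?_
    · exact (IntegrableOn.mono_set hu Set.Ioo_subset_Ioc_self).locallyIntegrableOn
    · have hout : ∀ x, x ∉ Set.Ioo (-Real.pi) Real.pi → φ x = 0 := fun x hx =>
        image_eq_zero_of_notMem_tsupport fun h' => hx (hsub h')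
      have hcont : Continuous (AddCircle.liftIoc (2 * Real.pi) (-Real.pi)
          (fun x => (φ x : ℂ))) := by
        refine AddCircle.liftIoc_continuous ?_ ?_
        · rw [hout _ (by simp), hout _ (by simp; intro; linarith)]
        · exact (Complex.continuous_ofReal.comp hφ.continuous).continuousOn
      have := hcirc ⟨_, hcont⟩
      rw [freq] at this
      rw [← setIntegral_eq_integral_of_forall_compl_eq_zero (s := Set.Ioc (-Real.pi) Real.pi),
        ← this]
      · refine setIntegral_congr_fun measurableSet_Ioc fun x hx => ?_
        simp only [ContinuousMap.coe_mk]
        rw [AddCircle.liftIoc_coe_apply (by rwa [show -Real.pi + 2 * Real.pi = Real.pi by ring])]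
        simp [mul_comm]
      · intro x hx
        rw [hout x fun h' => hx (Set.Ioo_subset_Ioc_self h'), zero_smul]
  rw [freq, ← restrict_Ioo_eq_restrict_Ioc]
  exact (ae_restrict_iff' measurableSet_Ioo).2 hIoo

/-- An integrable function with finitely many nonzero Fourier coefficients is a trigonometric
polynomial. -/
theorem ae_eq_sum_expo {u : ℝ → ℂ} (hu : Integrable u freq) (S : Finset ℤ)
    (h : ∀ j, j ∉ S → ∫ x, u x * expo (-j) x ∂freq = 0) :
    ∃ c : ℤ → ℂ, u =ᵐ[freq] fun x => ∑ j ∈ S, c j * expo j x := by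
  let c : ℤ → ℂ := fun j => (2 * Real.pi : ℂ)⁻¹ * ∫ x, u x * expo (-j) x ∂freq
  have hpi : (2 * Real.pi : ℂ) ≠ 0 := by
    simp [Real.pi_ne_zero]
  have hexpo : ∀ j, Integrable (expo j) freq := fun j => by
    simpa using integrable_mul_expo (integrable_const (1 : ℂ)) j
  have hsum : Integrable (fun x => ∑ j ∈ S, c j * expo j x) freq :=
    integrable_finsetSum _ fun j _ => (hexpo j).const_mul _
  refine ⟨c, ?_⟩
  -- Testing against `expo j` reads off the coefficient of index `-j`, hence the case split on `-j ∈
  -- S`.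
  have := ae_eq_zero_of_integral_mul_expo (hu.sub hsum) fun j => by
    simp only [sub_mul, Pi.sub_apply]
    rw [integral_sub (integrable_mul_expo hu j) (integrable_mul_expo hsum j)]
    simp only [Finset.sum_mul, mul_assoc, ← expo_add]
    rw [integral_finsetSum _ fun k _ => (hexpo _).const_mul _]
    simp only [integral_const_mul, integral_expo]
    simp only [mul_ite, mul_zero]
    by_cases hj : -j ∈ S
    · rw [Finset.sum_eq_single (-j)]
      · simp only [neg_add_cancel, if_true, c, neg_neg]
        field_simp
        ring
      · intro k _ hk
        rw [if_neg]; omega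
      · exact fun h' => absurd hj h'
    · rw [Finset.sum_eq_zero]
      · have := h _ hj
        rw [neg_neg] at this
        rw [this, sub_zero]
      · intro k hk
        rw [if_neg]
        intro h'
        apply hj
        have : k = -j := by omega
        rwa [← this]
  filter_upwards [this] with x hx
  simpa [sub_eq_zero] using hx

/-! ### Pointwise facts on `f (f + g)⁻¹` -/

section Pointwise

variable {n : Type*} [Fintype n]

theorem sform_mul_right (M M' : Matrix n n ℂ) (u v : n → ℂ) :
    sform (M * M') u v = sform M u (star (M'.mulVec (star v))) := by
  simp only [sform, ← Matrix.mulVec_mulVec, star_star]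

theorem sform_self_mono {f g : Matrix n n ℂ} (hg : g.PosSemidef) (u : n → ℂ) :
    (sform f u u).re ≤ (sform (f + g) u u).re := by
  rw [sform_add_matrix, Complex.add_re]
  linarith [sform_self_nonneg hg u]

theorem sform_self_mono' {f g : Matrix n n ℂ} (hf : f.PosSemidef) (u : n → ℂ) :
    (sform g u u).re ≤ (sform (f + g) u u).re := by
  rw [add_comm]; exact sform_self_mono hf u

variable [DecidableEq n]

theorem posDef_of_isUnit_det {M : Matrix n n ℂ} (hM : M.PosSemidef) (h : IsUnit M.det) :
    M.PosDef :=
  hM.posDef_iff_isUnit.2 ((Matrix.isUnit_iff_isUnit_det M).2 h)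

/-- This turns the plain pairing with `p` into the weighted form against `p M⁻¹`, the device that
makes Fourier coefficients bounded functionals on the weighted space. -/
theorem sform_vecMul_inv_right {M : Matrix n n ℂ} (hM : M.IsHermitian) (h : IsUnit M.det)
    (u p : n → ℂ) : sform M u (Matrix.vecMul p M⁻¹) = u ⬝ᵥ star p := by
  rw [sform, Matrix.star_vecMul, hM.inv.eq, Matrix.mulVec_mulVec, Matrix.mul_nonsing_inv _ h,
    Matrix.one_mulVec]

theorem sform_vecMul_inv_self {M : Matrix n n ℂ} (hM : M.IsHermitian) (h : IsUnit M.det)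
    (p : n → ℂ) : sform M (Matrix.vecMul p M⁻¹) (Matrix.vecMul p M⁻¹) = sform M⁻¹ p p := by
  rw [sform_vecMul_inv_right hM h, sform, Matrix.dotProduct_mulVec]

/-- With `u = p f (f + g)⁻¹`, the form of `f + g` at `u` equals `f[u, p]`, at most half of `f[u, u]
+ f[p, p]`. Since `f[u, u]` is bounded by the left side, half of it is absorbed. This puts `A f (f +
g)⁻¹` in `L₂(f + g)` although `A f` need not be bounded. -/
theorem sform_vecMul_mul_inv_self_le {f g : Matrix n n ℂ} (hf : f.PosSemidef) (hg : g.PosSemidef)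
    (h : IsUnit (f + g).det) (p : n → ℂ) :
    (sform (f + g) (Matrix.vecMul (Matrix.vecMul p f) (f + g)⁻¹)
      (Matrix.vecMul (Matrix.vecMul p f) (f + g)⁻¹)).re ≤ (sform f p p).re := by
  set u := Matrix.vecMul (Matrix.vecMul p f) (f + g)⁻¹
  have h1 : sform (f + g) u u = sform f u p := by
    rw [sform_vecMul_inv_right (hf.add hg).1 h, Matrix.star_vecMul, hf.1.eq, sform]
  have h2 := (Complex.re_le_norm _).trans (norm_sform_le hf u p)
  rw [← h1] at h2
  linarith [sform_self_mono (f := f) hg u]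

theorem norm_apply_le_trace {M : Matrix n n ℂ} (hM : M.PosSemidef) (ν μ : n) :
    ‖M ν μ‖ ≤ M.trace.re := by
  have hd : ∀ i, 0 ≤ (M i i).re := fun i => (Complex.le_def.1 hM.diag_nonneg).1
  have h1 := norm_sform_le hM (Pi.single ν 1) (Pi.single μ 1)
  simp only [sform_single] at h1
  have h2 : ∀ i, (M i i).re ≤ M.trace.re := fun i => by
    rw [Matrix.trace, Complex.re_sum]
    exact Finset.single_le_sum (f := fun i => (M i i).re) (fun j _ => hd j) (Finset.mem_univ i)
  linarith [h2 ν, h2 μ]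

/-- The entry is `f[e_ν, w]` with `w = e_μ (f + g)⁻¹`, and `f[w, w]` is at most the form of `f + g`
at `w`, which is a diagonal entry of the inverse. -/
theorem norm_mul_inv_apply_le {f g : Matrix n n ℂ} (hf : f.PosSemidef) (hg : g.PosSemidef)
    (h : IsUnit (f + g).det) (ν μ : n) :
    ‖(f * (f + g)⁻¹) ν μ‖ ≤ ((f ν ν).re + ((f + g)⁻¹ μ μ).re) / 2 := by
  have hF := (hf.add hg).1
  rw [← sform_single (f * (f + g)⁻¹), sform_mul_right]
  refine (norm_sform_le hf _ _).trans ?_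
  rw [sform_single]
  have h1 : star ((f + g)⁻¹.mulVec (star (Pi.single μ (1 : ℂ)))) =
      Matrix.vecMul (Pi.single μ (1 : ℂ)) (f + g)⁻¹ := by
    rw [Matrix.star_mulVec, star_star, hF.inv.eq]
  have h2 := sform_vecMul_inv_self hF h (Pi.single μ (1 : ℂ))
  rw [← h1, sform_single] at h2
  have h3 := sform_self_mono (f := f) hg (star ((f + g)⁻¹.mulVec (star (Pi.single μ (1 : ℂ)))))
  rw [h2] at h3
  linarith

/-- Here `w = e_μ g (f + g)⁻¹`, whose energy is controlled by `sform_vecMul_mul_inv_self_le` with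
`f` and `g` interchanged. -/
theorem norm_mul_inv_mul_apply_le {f g : Matrix n n ℂ} (hf : f.PosSemidef) (hg : g.PosSemidef)
    (h : IsUnit (f + g).det) (ν μ : n) :
    ‖(f * (f + g)⁻¹ * g) ν μ‖ ≤ ((f ν ν).re + (g μ μ).re) / 2 := by
  rw [← sform_single (f * (f + g)⁻¹ * g), Matrix.mul_assoc, sform_mul_right]
  refine (norm_sform_le hf _ _).trans ?_
  rw [sform_single]
  have h1 : star (((f + g)⁻¹ * g).mulVec (star (Pi.single μ (1 : ℂ)))) =
      Matrix.vecMul (Matrix.vecMul (Pi.single μ (1 : ℂ)) g) (f + g)⁻¹ := by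
    rw [Matrix.star_mulVec, star_star, Matrix.conjTranspose_mul, (hf.add hg).1.inv.eq, hg.1.eq,
      Matrix.vecMul_vecMul]
  have h2 := sform_vecMul_mul_inv_self_le hg hf (by rwa [add_comm]) (Pi.single μ (1 : ℂ))
  rw [add_comm g f, ← h1, sform_single] at h2
  linarith [sform_self_mono (f := f) hg
    (star (((f + g)⁻¹ * g).mulVec (star (Pi.single μ (1 : ℂ)))))]

/-- Symmetry of the parallel sum: both sides equal `f - f (f + g)⁻¹ f`. -/
theorem mul_inv_mul_comm {f g : Matrix n n ℂ} (h : IsUnit (f + g).det) :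
    g * (f + g)⁻¹ * f = f * (f + g)⁻¹ * g := by
  have h1 : g * (f + g)⁻¹ * f + f * (f + g)⁻¹ * f = f := by
    rw [← Matrix.add_mul, ← Matrix.add_mul, add_comm g f, Matrix.mul_nonsing_inv _ h, one_mul]
  have h2 : f * (f + g)⁻¹ * g + f * (f + g)⁻¹ * f = f := by
    rw [← Matrix.mul_add, add_comm g f, Matrix.mul_assoc, Matrix.nonsing_inv_mul _ h, mul_one]
  exact add_right_cancel (h1.trans h2.symm)

end Pointwise

/-! ### Weights -/

section Weights

variable {T : ℕ}

theorem aestronglyMeasurable_pi {α ι β : Type*} [Fintype ι] [MeasurableSpace α] {m : Measure α}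
    [TopologicalSpace β] [TopologicalSpace.PseudoMetrizableSpace β] [SecondCountableTopology β]
    {b : α → ι → β} (h : ∀ i, AEStronglyMeasurable (fun x => b x i) m) :
    AEStronglyMeasurable b m := by
  borelize β
  exact (aemeasurable_pi_lambda b fun i => (h i).aemeasurable).aestronglyMeasurable

theorem aestronglyMeasurable_coord {α ι β : Type*} [MeasurableSpace α] {m : Measure α}
    [TopologicalSpace β] {b : α → ι → β} (h : AEStronglyMeasurable b m) (i : ι) :
    AEStronglyMeasurable (fun x => b x i) m :=
  (continuous_apply i).comp_aestronglyMeasurable h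

theorem aestronglyMeasurable_entry {α m n : Type*} [MeasurableSpace α] {P : Measure α}
    {M : α → Matrix m n ℂ} (h : AEStronglyMeasurable M P) (ν : m) (μ : n) :
    AEStronglyMeasurable (fun x => M x ν μ) P :=
  (continuous_id.matrix_elem ν μ).comp_aestronglyMeasurable h

/-- An integrable, almost everywhere positive semidefinite matrix function. -/
structure IsWeight (f : ℝ → Matrix (Fin T) (Fin T) ℂ) : Prop where
  integrable : ∀ ν μ, Integrable (fun x => f x ν μ) freq
  posSemidef : ∀ᵐ x ∂freq, (f x).PosSemidef

variable {f g : ℝ → Matrix (Fin T) (Fin T) ℂ} {b d : ℝ → Fin T → ℂ}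

theorem IsWeight.aestronglyMeasurable (hf : IsWeight f) : AEStronglyMeasurable f freq :=
  aestronglyMeasurable_pi (β := Fin T → ℂ) fun ν => aestronglyMeasurable_pi fun μ =>
    (hf.integrable ν μ).1

theorem IsWeight.add (hf : IsWeight f) (hg : IsWeight g) : IsWeight fun x => f x + g x where
  integrable ν μ := (hf.integrable ν μ).add (hg.integrable ν μ)
  posSemidef := by filter_upwards [hf.posSemidef, hg.posSemidef] with x h1 h2 using h1.add h2

theorem aestronglyMeasurable_inv (hf : AEStronglyMeasurable f freq) :
    AEStronglyMeasurable (fun x => (f x)⁻¹) freq := by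
  have h1 : AEStronglyMeasurable (fun x => (f x).det) freq :=
    (continuous_id.matrix_det).comp_aestronglyMeasurable hf
  have h2 : AEStronglyMeasurable (fun x => (f x).adjugate) freq :=
    (continuous_id.matrix_adjugate).comp_aestronglyMeasurable hf
  simp only [Matrix.inv_def, Ring.inverse_eq_inv']
  exact h1.inv₀.smul h2

theorem aestronglyMeasurable_mul (hf : AEStronglyMeasurable f freq)
    (hg : AEStronglyMeasurable g freq) : AEStronglyMeasurable (fun x => f x * g x) freq :=
  Continuous.comp_aestronglyMeasurable₂ (g := fun a b : Matrix (Fin T) (Fin T) ℂ => a * b)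
    (by fun_prop) hf hg

theorem aestronglyMeasurable_vecMul (hb : AEStronglyMeasurable b freq)
    (hf : AEStronglyMeasurable f freq) :
    AEStronglyMeasurable (fun x => Matrix.vecMul (b x) (f x)) freq :=
  Continuous.comp_aestronglyMeasurable₂
    (g := fun (a : Fin T → ℂ) (b : Matrix (Fin T) (Fin T) ℂ) => Matrix.vecMul a b)
    (by fun_prop) hb hf

theorem aestronglyMeasurable_sform (hf : AEStronglyMeasurable f freq)
    (hb : AEStronglyMeasurable b freq) (hd : AEStronglyMeasurable d freq) :
    AEStronglyMeasurable (fun x => sform (f x) (b x) (d x)) freq := by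
  simp only [sform_eq_sum]
  refine Finset.aestronglyMeasurable_fun_sum _ fun ν _ =>
    Finset.aestronglyMeasurable_fun_sum _ fun μ _ => ?_
  exact ((aestronglyMeasurable_coord hb ν).mul (aestronglyMeasurable_entry hf ν μ)).mul
    (aestronglyMeasurable_coord hd μ).star

theorem IsWeight.inv (hf : IsWeight f) (hmin : Minimality f) : IsWeight fun x => (f x)⁻¹ where
  integrable ν μ := by
    refine hmin.2.re.mono'
      (aestronglyMeasurable_entry (aestronglyMeasurable_inv hf.aestronglyMeasurable) ν μ) ?_
    filter_upwards [hf.posSemidef] with x hx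
    exact norm_apply_le_trace hx.inv ν μ
  posSemidef := by filter_upwards [hf.posSemidef] with x hx using hx.inv

theorem integrable_mul_inv (hf : IsWeight f) (hg : IsWeight g)
    (hmin : Minimality fun x => f x + g x) (ν μ : Fin T) :
    Integrable (fun x => (f x * (f x + g x)⁻¹) ν μ) freq := by
  have hG := (hf.add hg).inv hmin
  refine (((hf.integrable ν ν).re.add (hG.integrable μ μ).re).div_const 2).mono'
    (aestronglyMeasurable_entry
      (aestronglyMeasurable_mul hf.aestronglyMeasurable hG.aestronglyMeasurable) ν μ) ?_
  filter_upwards [hf.posSemidef, hg.posSemidef, hmin.1] with x h1 h2 h3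
  exact norm_mul_inv_apply_le h1 h2 h3 ν μ

theorem IsWeight.mul_inv_mul (hf : IsWeight f) (hg : IsWeight g)
    (hmin : Minimality fun x => f x + g x) (ν μ : Fin T) :
    Integrable (fun x => (f x * (f x + g x)⁻¹ * g x) ν μ) freq := by
  have hG := (hf.add hg).inv hmin
  refine (((hf.integrable ν ν).re.add (hg.integrable μ μ).re).div_const 2).mono'
    (aestronglyMeasurable_entry (aestronglyMeasurable_mul (aestronglyMeasurable_mul
      hf.aestronglyMeasurable hG.aestronglyMeasurable) hg.aestronglyMeasurable) ν μ) ?_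
  filter_upwards [hf.posSemidef, hg.posSemidef, hmin.1] with x h1 h2 h3
  exact norm_mul_inv_mul_apply_le h1 h2 h3 ν μ

/-! ### The space `L₂(f)` -/

theorem aestronglyMeasurable_quadForm (hf : AEStronglyMeasurable f freq)
    (hb : AEStronglyMeasurable b freq) : AEStronglyMeasurable (quadForm f b) freq := by
  have := (aestronglyMeasurable_sform hf hb hb).re
  refine this.congr (ae_of_all _ fun x => ?_)
  exact (quadForm_eq f b x).symm

theorem quadForm_nonneg (hf : IsWeight f) (b : ℝ → Fin T → ℂ) : 0 ≤ᵐ[freq] quadForm f b := by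
  filter_upwards [hf.posSemidef] with x hx
  rw [quadForm_eq]; exact sform_self_nonneg hx _

theorem integral_quadForm_nonneg (hf : IsWeight f) (b : ℝ → Fin T → ℂ) :
    0 ≤ ∫ x, quadForm f b x ∂freq := integral_nonneg_of_ae (quadForm_nonneg hf b)

theorem MemL2.integrable_sform (hf : IsWeight f) (hb : MemL2 f b) (hd : MemL2 f d) :
    Integrable (fun x => sform (f x) (b x) (d x)) freq := by
  refine ((hb.2.add hd.2).div_const 2).mono'
    (aestronglyMeasurable_sform hf.aestronglyMeasurable hb.1 hd.1) ?_
  filter_upwards [hf.posSemidef] with x hx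
  simp only [Pi.add_apply, quadForm_eq]
  exact norm_sform_le hx _ _

theorem MemL2.of_le (hf : IsWeight f) (hb : AEStronglyMeasurable b freq) {φ : ℝ → ℝ}
    (hφ : Integrable φ freq) (h : ∀ᵐ x ∂freq, quadForm f b x ≤ φ x) : MemL2 f b := by
  refine ⟨hb, hφ.mono' (aestronglyMeasurable_quadForm hf.aestronglyMeasurable hb) ?_⟩
  filter_upwards [h, quadForm_nonneg hf b] with x h1 h2
  rwa [Real.norm_of_nonneg h2]

theorem MemL2.sub (hf : IsWeight f) (hb : MemL2 f b) (hd : MemL2 f d) :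
    MemL2 f fun x => b x - d x := by
  refine .of_le hf (hb.1.sub hd.1) ((hb.2.const_mul 2).add (hd.2.const_mul 2)) ?_
  filter_upwards [hf.posSemidef] with x hx
  simp only [Pi.add_apply, quadForm_eq]
  exact sform_self_sub_le hx _ _

theorem integral_quadForm_sub_le (hf : IsWeight f) (hb : MemL2 f b) (hd : MemL2 f d) :
    ∫ x, quadForm f (fun x => b x - d x) x ∂freq ≤
      2 * ∫ x, quadForm f b x ∂freq + 2 * ∫ x, quadForm f d x ∂freq := by
  rw [← integral_const_mul, ← integral_const_mul,
    ← integral_add (hb.2.const_mul 2) (hd.2.const_mul 2)]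
  refine integral_mono_ae (hb.sub hf hd).2 ((hb.2.const_mul 2).add (hd.2.const_mul 2)) ?_
  filter_upwards [hf.posSemidef] with x hx
  simp only [quadForm_eq]
  exact sform_self_sub_le hx _ _

theorem MemL2.left (hf : IsWeight f) (hg : IsWeight g) (hb : MemL2 (fun x => f x + g x) b) :
    MemL2 f b := by
  refine .of_le hf hb.1 hb.2 ?_
  filter_upwards [hg.posSemidef] with x hx
  simp only [quadForm_eq]
  exact sform_self_mono hx _

theorem MemL2.right (hf : IsWeight f) (hg : IsWeight g) (hb : MemL2 (fun x => f x + g x) b) :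
    MemL2 g b := by
  refine .of_le hg hb.1 hb.2 ?_
  filter_upwards [hf.posSemidef] with x hx
  simp only [quadForm_eq]
  exact sform_self_mono' hx _

theorem quadForm_le_of_norm_le {C : ℝ} {x : ℝ} (hC : ∀ ν, ‖b x ν‖ ≤ C) :
    quadForm f b x ≤ C ^ 2 * ∑ ν, ∑ μ, ‖f x ν μ‖ := by
  refine (Complex.re_le_norm _).trans ((norm_sum_le _ _).trans ?_)
  rw [Finset.mul_sum]
  refine Finset.sum_le_sum fun ν _ => (norm_sum_le _ _).trans ?_
  rw [Finset.mul_sum]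
  refine Finset.sum_le_sum fun μ _ => ?_
  rw [norm_mul, norm_mul, RCLike.norm_conj]
  have h0 : 0 ≤ C := (norm_nonneg _).trans (hC ν)
  calc ‖b x ν‖ * ‖f x ν μ‖ * ‖b x μ‖ ≤ C * ‖f x ν μ‖ * C := by
        gcongr
        · exact hC ν
        · exact hC μ
    _ = _ := by ring

theorem IsWeight.integrable_sum_norm (hf : IsWeight f) :
    Integrable (fun x => ∑ ν, ∑ μ, ‖f x ν μ‖) freq :=
  integrable_finsetSum _ fun ν _ => integrable_finsetSum _ fun μ _ => (hf.integrable ν μ).norm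

theorem MemL2.of_bounded (hf : IsWeight f) (hb : AEStronglyMeasurable b freq) {C : ℝ}
    (hC : ∀ x ν, ‖b x ν‖ ≤ C) : MemL2 f b :=
  .of_le hf hb (hf.integrable_sum_norm.const_mul (C ^ 2))
    (ae_of_all _ fun x => quadForm_le_of_norm_le (hC x))

end Weights

/-! ### Inner products and norms of classes in `L²` -/

theorem inner_toLp {α E : Type*} [MeasurableSpace α] {m : Measure α} [NormedAddCommGroup E]
    [InnerProductSpace ℂ E] {u v : α → E} (hu : MemLp u 2 m) (hv : MemLp v 2 m) :
    inner ℂ hu.toLp hv.toLp = ∫ x, inner ℂ (u x) (v x) ∂m := by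
  rw [L2.inner_def]
  refine integral_congr_ae ?_
  filter_upwards [hu.coeFn_toLp, hv.coeFn_toLp] with x h1 h2
  rw [h1, h2]

theorem norm_toLp_sq {α E : Type*} [MeasurableSpace α] {m : Measure α} [NormedAddCommGroup E]
    [InnerProductSpace ℂ E] {u : α → E} (hu : MemLp u 2 m) :
    ‖hu.toLp‖ ^ 2 = ∫ x, ‖u x‖ ^ 2 ∂m := by
  have h := inner_toLp hu hu
  simp only [inner_self_eq_norm_sq_to_K] at h
  have h1 : ∀ x, ((‖u x‖ : ℝ) : ℂ) ^ 2 = ((‖u x‖ ^ 2 : ℝ) : ℂ) := fun x => by push_cast; rfl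
  simp only [Complex.coe_algebraMap, h1, integral_complex_ofReal] at h
  exact_mod_cast h

/-! ### Vector trigonometric polynomials -/

section TrigPoly

variable {T : ℕ}

theorem trigPoly_eq_lsum (p : ℤ →₀ (Fin T → ℂ)) (x : ℝ) :
    trigPoly p x = Finsupp.lsum ℂ (fun j => expo j x • (LinearMap.id : (Fin T → ℂ) →ₗ[ℂ] _)) p := by
  simp [trigPoly, Finsupp.sum]

theorem trigPoly_add (p q : ℤ →₀ (Fin T → ℂ)) (x : ℝ) :
    trigPoly (p + q) x = trigPoly p x + trigPoly q x := by simp only [trigPoly_eq_lsum, map_add]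

theorem trigPoly_sub (p q : ℤ →₀ (Fin T → ℂ)) (x : ℝ) :
    trigPoly (p - q) x = trigPoly p x - trigPoly q x := by simp only [trigPoly_eq_lsum, map_sub]

theorem trigPoly_smul (c : ℂ) (p : ℤ →₀ (Fin T → ℂ)) (x : ℝ) :
    trigPoly (c • p) x = c • trigPoly p x := by simp only [trigPoly_eq_lsum, map_smul]

theorem trigPoly_zero (x : ℝ) : trigPoly (0 : ℤ →₀ (Fin T → ℂ)) x = 0 := by
  simp only [trigPoly_eq_lsum, map_zero]

theorem trigPoly_single (j : ℤ) (v : Fin T → ℂ) (x : ℝ) :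
    trigPoly (Finsupp.single j v) x = expo j x • v := by
  rw [trigPoly_eq_lsum]; simp

theorem continuous_trigPoly (p : ℤ →₀ (Fin T → ℂ)) : Continuous (trigPoly p) :=
  continuous_finsetSum _ fun j _ => (continuous_expo j).smul continuous_const

theorem norm_trigPoly_apply_le (p : ℤ →₀ (Fin T → ℂ)) (x : ℝ) (ν : Fin T) :
    ‖trigPoly p x ν‖ ≤ ∑ j ∈ p.support, ‖p j‖ := by
  refine (norm_le_pi_norm _ ν).trans ((norm_sum_le _ _).trans (Finset.sum_le_sum fun j _ => ?_))
  rw [norm_smul, norm_expo, one_mul]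

variable {f : ℝ → Matrix (Fin T) (Fin T) ℂ} {h b : ℝ → Fin T → ℂ}

theorem memL2_trigPoly (hf : IsWeight f) (p : ℤ →₀ (Fin T → ℂ)) : MemL2 f (trigPoly p) :=
  .of_bounded hf (continuous_trigPoly p).aestronglyMeasurable (norm_trigPoly_apply_le p)

/-! ### The subspace `L₂^{s-}(f)` -/

/-- A bounded antilinear functional on `L₂(f)` that vanishes on the generators vanishes on the
subspace. -/
theorem MemL2Minus.integral_sform_eq_zero (hf : IsWeight f) {S : Set ℤ} (hh : MemL2Minus f S h)
    (hb : MemL2 f b)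
    (hz : ∀ p : ℤ →₀ (Fin T → ℂ), (∀ j ∈ p.support, j ∉ S) →
      ∫ x, sform (f x) (trigPoly p x) (b x) ∂freq = 0) :
    ∫ x, sform (f x) (h x) (b x) ∂freq = 0 := by
  set B := ∫ x, quadForm f b x ∂freq
  have hB : 0 ≤ B := integral_quadForm_nonneg hf b
  refine norm_le_zero_iff.1 (le_of_forall_pos_le_add fun δ hδ => ?_)
  -- Scaling the error by `t` and `b` by `1 / t` leaves their pairing unchanged: `t` is chosen large
  -- for the term in `b`, then the approximation fine enough to offset `t ^ 2`. The `+ 1` in the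
  -- witness keeps `t` positive when `B = 0`.
  obtain ⟨t, ht, htB⟩ : ∃ t : ℝ, 0 < t ∧ B / t ^ 2 ≤ δ := by
    refine ⟨Real.sqrt ((B + 1) / δ), by positivity, ?_⟩
    rw [Real.sq_sqrt (by positivity), div_div_eq_mul_div, div_le_iff₀ (by positivity)]
    nlinarith
  obtain ⟨p, hp, hpε⟩ := hh.2 (δ / t ^ 2) (by positivity)
  have hd := hh.1.sub hf (memL2_trigPoly hf p)
  have h1 : ∫ x, sform (f x) (h x) (b x) ∂freq =
      ∫ x, sform (f x) (h x - trigPoly p x) (b x) ∂freq := by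
    simp only [sform_sub_left]
    rw [integral_sub (hh.1.integrable_sform hf hb) ((memL2_trigPoly hf p).integrable_sform hf hb),
      hz p hp, sub_zero]
  rw [h1]
  refine (norm_integral_le_integral_norm _).trans ?_
  have h2 : ∫ x, ‖sform (f x) (h x - trigPoly p x) (b x)‖ ∂freq ≤
      ∫ x, (t ^ 2 * quadForm f (fun x => h x - trigPoly p x) x +
        1 / t ^ 2 * quadForm f b x) / 2 ∂freq := by
    refine integral_mono_ae (hd.integrable_sform hf hb).norm
      (((hd.2.const_mul _).add (hb.2.const_mul _)).div_const 2) ?_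
    filter_upwards [hf.posSemidef] with x hx
    have h3 := norm_sform_le hx ((t : ℂ) • (h x - trigPoly p x)) (((1 / t : ℝ) : ℂ) • b x)
    simp only [sform_smul_left, sform_smul_right, Complex.conj_ofReal, ← mul_assoc,
      ← Complex.ofReal_mul, Complex.re_ofReal_mul] at h3
    rw [one_div_mul_cancel ht.ne', Complex.ofReal_one, one_mul] at h3
    simp only [quadForm_eq, sq, ← one_div_mul_one_div]
    exact h3
  refine h2.trans ?_
  rw [integral_div, integral_add (hd.2.const_mul _) (hb.2.const_mul _), integral_const_mul,
    integral_const_mul]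
  have h4 : t ^ 2 * ∫ x, quadForm f (fun x => h x - trigPoly p x) x ∂freq ≤ δ := by
    have := mul_le_mul_of_nonneg_left hpε.le (sq_nonneg t)
    rwa [mul_div_cancel₀ _ (by positivity)] at this
  have h5 : 1 / t ^ 2 * B ≤ δ := by rwa [one_div_mul_eq_div]
  linarith

/-- The energy of `p f⁻¹` in the weight `f` is that of `p` in the weight `f⁻¹`, which is integrable
by minimality since `p` is bounded. -/
theorem MemL2.vecMul_inv (hf : IsWeight f) (hmin : Minimality f) {p : ℝ → Fin T → ℂ}
    (hp : AEStronglyMeasurable p freq) {C : ℝ} (hC : ∀ x ν, ‖p x ν‖ ≤ C) :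
    MemL2 f fun x => Matrix.vecMul (p x) (f x)⁻¹ := by
  have hG := hf.inv hmin
  refine .of_le hf (aestronglyMeasurable_vecMul hp hG.aestronglyMeasurable)
    (MemL2.of_bounded hG hp hC).2 ?_
  filter_upwards [hf.posSemidef, hmin.1] with x h1 h2
  rw [quadForm_eq, quadForm_eq, sform_vecMul_inv_self h1.1 h2]

theorem MemL2.integrable_dotProduct (hf : IsWeight f) (hmin : Minimality f) (hh : MemL2 f h)
    {p : ℝ → Fin T → ℂ} (hp : AEStronglyMeasurable p freq) {C : ℝ} (hC : ∀ x ν, ‖p x ν‖ ≤ C) :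
    Integrable (fun x => h x ⬝ᵥ star (p x)) freq := by
  refine (hh.integrable_sform hf (MemL2.vecMul_inv hf hmin hp hC)).congr ?_
  filter_upwards [hf.posSemidef, hmin.1] with x h1 h2
  rw [sform_vecMul_inv_right h1.1 h2]

theorem MemL2.integrable_coord (hf : IsWeight f) (hmin : Minimality f) (hh : MemL2 f h)
    (ν : Fin T) : Integrable (fun x => h x ν) freq := by
  have := hh.integrable_dotProduct hf hmin (p := fun _ => Pi.single ν 1) (C := 1)
    aestronglyMeasurable_const fun x μ => by
      rw [Pi.single_apply]; split_ifs <;> simp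
  simpa using this

/-- The Fourier coefficients of an element of `L₂^{s-}(f)` vanish on `S`. -/
theorem MemL2Minus.integral_mul_expo_eq_zero (hf : IsWeight f) (hmin : Minimality f) {S : Set ℤ}
    (hh : MemL2Minus f S h) {k : ℤ} (hk : k ∈ S) (ν : Fin T) :
    ∫ x, h x ν * expo (-k) x ∂freq = 0 := by
  set q : ℝ → Fin T → ℂ := trigPoly (Finsupp.single k (Pi.single ν 1))
  have hq : ∀ u x, u ⬝ᵥ star (q x) = u ν * expo (-k) x := fun u x => by
    simp only [q, trigPoly_single, star_smul, dotProduct_smul, Complex.star_def, conj_expo,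
      smul_eq_mul, ← Pi.single_star, star_one, dotProduct_single_one, mul_comm]
  have hb := MemL2.vecMul_inv hf hmin (continuous_trigPoly _).aestronglyMeasurable
    (norm_trigPoly_apply_le (Finsupp.single k (Pi.single ν 1)))
  have hs : ∀ᵐ x ∂freq, ∀ u, sform (f x) u (Matrix.vecMul (q x) (f x)⁻¹) =
      u ν * expo (-k) x := by
    filter_upwards [hf.posSemidef, hmin.1] with x h1 h2 u
    rw [sform_vecMul_inv_right h1.1 h2, hq]
  rw [← hh.integral_sform_eq_zero hf hb fun p hp => ?_]
  · exact integral_congr_ae (hs.mono fun x hx => (hx _).symm)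
  · rw [integral_congr_ae (hs.mono fun x hx => hx _)]
    simp only [trigPoly, Finset.sum_apply, Pi.smul_apply, smul_eq_mul, Finset.sum_mul]
    have h1 : ∀ j x, expo j x * p j ν * expo (-k) x = p j ν * expo (j + -k) x := fun j x => by
      rw [expo_add]; ring
    simp only [h1]
    rw [integral_finsetSum _ fun j _ => by
      simpa using integrable_mul_expo (integrable_const (p j ν)) (j + -k)]
    refine Finset.sum_eq_zero fun j hj => ?_
    rw [integral_const_mul, integral_expo, if_neg, mul_zero]
    intro h'
    exact hp j hj (by rwa [show j = k by omega])

/-- An element of `L₂(f)` whose Fourier coefficients vanish on the finite set `S` belongs to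
`L₂^{s-}(f)`. -/
theorem memL2Minus_of_integral_mul_expo_eq_zero (hf : IsWeight f) (hmin : Minimality f)
    (S : Finset ℤ) (hh : MemL2 f h)
    (hz : ∀ k ∈ S, ∀ ν, ∫ x, h x ν * expo (-k) x ∂freq = 0) : MemL2Minus f S h := by
  obtain ⟨Q, hQm, hQ⟩ := exists_measurable_factor hf.aestronglyMeasurable hf.posSemidef
  let Φ : (ℝ → Fin T → ℂ) → ℝ → EuclideanSpace ℂ (Fin T) := fun b x => WithLp.toLp 2 ((Q x).mulVec (b x))
  have hΦm : ∀ b, AEStronglyMeasurable b freq → AEStronglyMeasurable (Φ b) freq := fun b hb =>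
    (PiLp.continuous_toLp 2 _).comp_aestronglyMeasurable (Continuous.comp_aestronglyMeasurable₂
      (g := fun (M : Matrix (Fin T) (Fin T) ℂ) (a : Fin T → ℂ) => M.mulVec a)
      (by fun_prop) hQm hb)
  have hΦi : ∀ b d, ∀ᵐ x ∂freq, inner ℂ (Φ b x) (Φ d x) = sform (f x) (d x) (b x) := by
    intro b d
    filter_upwards [hQ] with x hx
    rw [EuclideanSpace.inner_eq_star_dotProduct]
    simp only [Φ]
    rw [Matrix.star_mulVec, dotProduct_comm, ← Matrix.dotProduct_mulVec, Matrix.mulVec_mulVec, hx,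
      Matrix.mulVec_transpose, dotProduct_comm, ← Matrix.dotProduct_mulVec, sform]
  have hΦq : ∀ b, ∀ᵐ x ∂freq, ‖Φ b x‖ ^ 2 = quadForm f b x := by
    intro b
    filter_upwards [hΦi b b] with x hx
    rw [← inner_self_eq_norm_sq (𝕜 := ℂ), hx, quadForm_eq]; rfl
  have hΦ : ∀ b, MemL2 f b → MemLp (Φ b) 2 freq := fun b hb =>
    (memLp_two_iff_integrable_sq_norm (hΦm b hb.1)).2
      (hb.2.congr ((hΦq b).mono fun x hx => hx.symm))
  let Ψ : (ℤ →₀ (Fin T → ℂ)) →ₗ[ℂ] Lp (EuclideanSpace ℂ (Fin T)) 2 freq :=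
    { toFun := fun p => (hΦ _ (memL2_trigPoly hf p)).toLp
      map_add' := fun p q => by
        rw [← MemLp.toLp_add]
        congr 1; ext x
        simp [Φ, trigPoly_add, Matrix.mulVec_add]
      map_smul' := fun c p => by
        rw [RingHom.id_apply, ← MemLp.toLp_const_smul]
        congr 1; ext x
        simp [Φ, trigPoly_smul, Matrix.mulVec_smul] }
  let W : Submodule ℂ (Lp (EuclideanSpace ℂ (Fin T)) 2 freq) :=
    (Finsupp.supported (Fin T → ℂ) ℂ {j : ℤ | j ∉ S}).map Ψ
  -- `Φ` embeds `L₂(f)` isometrically and `W` is the image of the polynomials without frequencies in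
  -- `S`. The double orthogonal complement of `W` is its closure, so membership there gives the
  -- approximation.
  have hmem : (hΦ h hh).toLp ∈ Wᗮᗮ := by
    rw [Submodule.mem_orthogonal]
    intro u hu
    -- `u` need not be in the range of `Φ`; only its pairings `w ν` with the embedded basis vectors
    -- matter.
    let w : Fin T → ℝ → ℂ := fun ν x => inner ℂ (u x) (Φ (fun _ => Pi.single ν 1) x)
    have hδ : ∀ ν, MemL2 f (fun _ => Pi.single ν (1 : ℂ)) := fun ν =>
      .of_bounded hf aestronglyMeasurable_const (C := 1) fun x μ => by
        rw [Pi.single_apply]; split_ifs <;> simp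
    have hwi : ∀ ν, Integrable (w ν) freq := fun ν => by
      refine (L2.integrable_inner (𝕜 := ℂ) u (hΦ _ (hδ ν)).toLp).congr ?_
      filter_upwards [(hΦ _ (hδ ν)).coeFn_toLp] with x hx
      rw [hx]
    have hw : ∀ (b : ℝ → Fin T → ℂ) x, inner ℂ (u x) (Φ b x) = ∑ ν, b x ν * w ν x := by
      intro b x
      have h1 : ∀ a : Fin T → ℂ, inner ℂ (u x) (WithLp.toLp 2 ((Q x).mulVec a)) =
          Matrix.vecMul (star (u x).ofLp) (Q x) ⬝ᵥ a := fun a => by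
        rw [EuclideanSpace.inner_eq_star_dotProduct, dotProduct_comm, Matrix.dotProduct_mulVec]
      simp only [w, Φ, h1, dotProduct_single_one]
      rw [dotProduct_comm, dotProduct]
    have hwint : ∀ b (hb : MemL2 f b),
        inner ℂ u (hΦ b hb).toLp = ∫ x, ∑ ν, b x ν * w ν x ∂freq := by
      intro b hb
      rw [L2.inner_def]
      refine integral_congr_ae ?_
      filter_upwards [(hΦ b hb).coeFn_toLp] with x hx
      rw [hx, hw]
    have hwz : ∀ ν, ∀ j ∉ S, ∫ x, w ν x * expo j x ∂freq = 0 := by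
      intro ν j hj
      have h1 : inner ℂ u (Ψ (Finsupp.single j (Pi.single ν 1))) = 0 := by
        refine inner_eq_zero_symm.1 ((Submodule.mem_orthogonal _ _).1 hu _ ?_)
        exact Submodule.mem_map_of_mem (Finsupp.single_mem_supported ℂ _ hj)
      rw [← h1]
      refine Eq.trans ?_ (hwint _ (memL2_trigPoly hf _)).symm
      congr 1; ext x
      rw [Finset.sum_eq_single ν]
      · simp [trigPoly_single, mul_comm]
      · intro μ _ hμ
        simp [trigPoly_single, hμ]
      · simp
    -- Orthogonality to the generators leaves `w ν` only frequencies in `-S`, so pairing with `h`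
    -- involves only the coefficients of `h` on `S`, which vanish.
    have hwc : ∀ ν, ∃ c : ℤ → ℂ, w ν =ᵐ[freq] fun x => ∑ j ∈ S.image Neg.neg, c j * expo j x :=
      fun ν => ae_eq_sum_expo (hwi ν) _ fun j hj => hwz ν _ fun h' =>
        hj (Finset.mem_image.2 ⟨-j, h', neg_neg j⟩)
    choose c hc using hwc
    refine (hwint h hh).trans ?_
    have h2 : (fun x => ∑ ν, h x ν * w ν x) =ᵐ[freq]
        fun x => ∑ ν, ∑ j ∈ S.image Neg.neg, c ν j * (h x ν * expo j x) := by
      filter_upwards [ae_all_iff.2 hc] with x hx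
      refine Finset.sum_congr rfl fun ν _ => ?_
      rw [hx, Finset.mul_sum]
      exact Finset.sum_congr rfl fun j _ => by ring
    have hi := fun ν j =>
      (integrable_mul_expo (hh.integrable_coord hf hmin ν) j).const_mul (c ν j)
    rw [integral_congr_ae h2, integral_finsetSum _ fun ν _ => integrable_finsetSum _ fun j _ =>
      hi ν j]
    refine Finset.sum_eq_zero fun ν _ => ?_
    rw [integral_finsetSum _ fun j _ => hi ν j]
    refine Finset.sum_eq_zero fun j hj => ?_
    obtain ⟨k, hk, rfl⟩ := Finset.mem_image.1 hj
    rw [integral_const_mul, hz k hk, mul_zero]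
  rw [Submodule.orthogonal_orthogonal_eq_closure] at hmem
  refine ⟨hh, fun ε hε => ?_⟩
  obtain ⟨_, ⟨p, hp, rfl⟩, hpε⟩ := SeminormedAddCommGroup.mem_closure_iff.1
    (show (hΦ h hh).toLp ∈ closure (W : Set _) from hmem) (Real.sqrt ε) (by positivity)
  refine ⟨p, fun j hj => hp hj, ?_⟩
  have h1 : ‖(hΦ h hh).toLp - Ψ p‖ ^ 2 =
      ∫ x, quadForm f (fun x => h x - trigPoly p x) x ∂freq := by
    change ‖(hΦ h hh).toLp - (hΦ _ (memL2_trigPoly hf p)).toLp‖ ^ 2 = _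
    rw [← MemLp.toLp_sub, norm_toLp_sq]
    refine integral_congr_ae ?_
    filter_upwards [hΦq fun x => h x - trigPoly p x] with x hx
    rw [← hx]
    simp [Φ, Matrix.mulVec_sub]
  rw [← h1, ← Real.sq_sqrt hε.le]
  gcongr

end TrigPoly

/-! ### The missing times -/

section Times

variable (N K : ℕ → ℕ) (s : ℕ)

/-- A block ends no later than the offset of any later block, so blocks are disjoint and `time`
enumerates the missing times without repetition. -/
theorem blockStart_add_le {l m : ℕ} (h : l < m) :
    blockStart N K l + N (l + 1) ≤ blockStart N K m := by
  have h1 : blockStart N K (l + 1) = blockStart N K l + (N (l + 1) + K (l + 1)) :=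
    Finset.sum_range_succ _ _
  have h2 : blockStart N K (l + 1) ≤ blockStart N K m :=
    Finset.sum_le_sum_of_subset (Finset.range_mono (by omega))
  omega

theorem time_injective : Function.Injective (time N K (s := s)) := by
  rintro ⟨l, i⟩ ⟨m, j⟩ h
  simp only [time] at h
  have hi := i.2
  have hj := j.2
  have hlm : l = m := by
    apply Fin.ext
    rcases lt_trichotomy (l : ℕ) m with h' | h' | h'
    · have := blockStart_add_le N K h'; omega
    · exact h'
    · have := blockStart_add_le N K h'; omega
  subst hlm
  have : i = j := Fin.ext (by omega)
  rw [this]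

/-- The missing times as a finite set. -/
def missingFinset : Finset ℤ := Finset.univ.image (time N K (s := s))

theorem sum_Icc_eq_sum_fin {β : Type*} [AddCommMonoid β] (M : ℤ) (n : ℕ) (φ : ℤ → β) :
    ∑ j ∈ Finset.Icc (M + 1) (M + n), φ j = ∑ i : Fin n, φ (M + 1 + ((i : ℕ) : ℤ)) := by
  rw [Fin.sum_univ_eq_sum_range (fun i => φ (M + 1 + (i : ℤ)))]
  refine Finset.sum_nbij' (fun j => (j - M - 1).toNat) (fun i => M + 1 + (i : ℤ)) ?_ ?_ ?_ ?_ ?_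
  · intro j hj; simp only [Finset.mem_Icc, Finset.mem_range] at *; omega
  · intro j hj; simp only [Finset.mem_Icc, Finset.mem_range] at *; omega
  · intro j hj; simp only [Finset.mem_Icc] at *; omega
  · intro j hj; simp only [Finset.mem_range] at *; omega
  · intro j hj; simp only [Finset.mem_Icc] at *; congr 1; omega

theorem missing_eq : missing N K s = (missingFinset N K s : Set ℤ) := by
  ext j
  simp only [missing, missingFinset, Set.mem_iUnion, Set.mem_Icc, Finset.coe_image, Finset.coe_univ,
    Set.image_univ, Set.mem_range, Finset.mem_range, exists_prop]
  constructor
  · rintro ⟨l, hl, h1, h2⟩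
    refine ⟨⟨⟨l, hl⟩, ⟨(j - blockStart N K l - 1).toNat, by simp only; omega⟩⟩, ?_⟩
    simp only [time]
    omega
  · rintro ⟨⟨l, i⟩, rfl⟩
    have := i.2
    refine ⟨l, l.2, ?_, ?_⟩ <;> simp only [time] <;> omega

theorem time_mem_missing (k : Pos N s) : time N K k ∈ missing N K s := by
  rw [missing_eq]
  exact Finset.mem_coe.2 (Finset.mem_image_of_mem _ (Finset.mem_univ k))

theorem functional_eq {Ω : Type*} {T : ℕ} (a : ℤ → Fin T → ℂ) (ξ : ℤ → Ω → Fin T → ℂ) (ω : Ω) :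
    functional N K s a ξ ω =
      ∑ k : Pos N s, ∑ ν, a (time N K k) ν * ξ (time N K k) ω ν := by
  rw [functional, Finset.sum_range (n := s), Fintype.sum_sigma]
  exact Finset.sum_congr rfl fun l _ => sum_Icc_eq_sum_fin _ _ _

end Times

/-! ### Block Toeplitz matrices -/

section Toeplitz

variable {N K : ℕ → ℕ} {s T : ℕ}

theorem vecPoly_eq_trigPoly (v : Pos N s × Fin T → ℂ) :
    vecPoly N K s v =
      trigPoly (∑ k : Pos N s, Finsupp.single (time N K k) fun ν => v (k, ν)) := by
  ext x ν
  simp [vecPoly, trigPoly_eq_lsum, mul_comm]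

theorem integral_vecPoly_mul_expo (v : Pos N s × Fin T → ℂ) (k : Pos N s) (ν : Fin T) :
    ∫ x, vecPoly N K s v x ν * expo (-time N K k) x ∂freq = 2 * Real.pi * v (k, ν) := by
  have h1 : ∀ x, vecPoly N K s v x ν * expo (-time N K k) x =
      ∑ j, v (j, ν) * expo (time N K j + -time N K k) x := fun x => by
    simp only [vecPoly, Finset.sum_mul, expo_add, mul_assoc]
  simp only [h1]
  rw [integral_finsetSum _ fun j _ => by
    simpa using integrable_mul_expo (integrable_const (v (j, ν))) _]
  simp only [integral_const_mul, integral_expo]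
  rw [Finset.sum_eq_single k]
  · simp [mul_comm]
  · intro j _ hj
    rw [if_neg, mul_zero]
    intro h
    exact hj (time_injective N K s (by omega))
  · simp

variable {G : ℝ → Matrix (Fin T) (Fin T) ℂ}

theorem integrable_vecMul (hG : ∀ ν μ, Integrable (fun x => G x ν μ) freq)
    (p : ℤ →₀ (Fin T → ℂ)) (ν : Fin T) :
    Integrable (fun x => Matrix.vecMul (trigPoly p x) (G x) ν) freq := by
  simp only [Matrix.vecMul, dotProduct]
  exact integrable_finsetSum _ fun μ _ => (hG μ ν).bdd_mul
    ((continuous_apply μ).comp (continuous_trigPoly p)).aestronglyMeasurable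
    (ae_of_all _ fun x => norm_trigPoly_apply_le p x μ)

/-- Block Toeplitz multiplication takes Fourier coefficients on `S` of the row vector `Vᵀ G`, where
`V` is the polynomial of `v`. The transpose in the blocks accounts for `G` acting from the right. -/
theorem blockToeplitz_mulVec (hG : ∀ ν μ, Integrable (fun x => G x ν μ) freq)
    (v : Pos N s × Fin T → ℂ) (k : Pos N s) (ν : Fin T) :
    (blockToeplitz N K s G).mulVec v (k, ν) = (1 / (2 * Real.pi) : ℂ) *
      ∫ x, Matrix.vecMul (vecPoly N K s v x) (G x) ν * expo (-time N K k) x ∂freq := by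
  have h1 : ∀ x, Matrix.vecMul (vecPoly N K s v x) (G x) ν * expo (-time N K k) x =
      ∑ j : Pos N s × Fin T,
        G x j.2 ν * expo (time N K j.1 - time N K k) x * v j := fun x => by
    rw [Fintype.sum_prod_type, Finset.sum_comm]
    simp only [Matrix.vecMul, dotProduct, vecPoly, Finset.sum_mul, sub_eq_add_neg, expo_add]
    exact Finset.sum_congr rfl fun _ _ => Finset.sum_congr rfl fun _ _ => by ring
  simp only [h1]
  rw [integral_finsetSum _ fun j _ => (integrable_mul_expo (hG j.2 ν) _).mul_const _,
    Finset.mul_sum]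
  simp only [integral_mul_const, Matrix.mulVec, dotProduct, blockToeplitz, Matrix.of_apply,
    Matrix.transpose_apply]
  exact Finset.sum_congr rfl fun _ _ => mul_assoc _ _ _

/-- The conjugation appears because the matrix stands in the antilinear slot of `scalarProd`. -/
theorem scalarProd_blockToeplitz (hG : ∀ ν μ, Integrable (fun x => G x ν μ) freq)
    (u v : Pos N s × Fin T → ℂ) :
    scalarProd u ((blockToeplitz N K s G).mulVec v) = conj ((1 / (2 * Real.pi) : ℂ) *
      ∫ x, sform (G x) (vecPoly N K s v x) (vecPoly N K s u x) ∂freq) := by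
  have h1 : ∀ x, sform (G x) (vecPoly N K s v x) (vecPoly N K s u x) =
      ∑ j : Pos N s × Fin T, conj (u j) *
        (Matrix.vecMul (vecPoly N K s v x) (G x) j.2 * expo (-time N K j.1) x) := fun x => by
    rw [Fintype.sum_prod_type, Finset.sum_comm, sform, Matrix.dotProduct_mulVec, dotProduct]
    refine Finset.sum_congr rfl fun ν _ => ?_
    simp only [Pi.star_apply, vecPoly, star_sum, star_mul', Finset.mul_sum, Complex.star_def,
      conj_expo]
    exact Finset.sum_congr rfl fun _ _ => by ring
  have hi : ∀ j : Pos N s × Fin T, Integrable (fun x =>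
      Matrix.vecMul (vecPoly N K s v x) (G x) j.2 * expo (-time N K j.1) x) freq := fun j => by
    rw [vecPoly_eq_trigPoly]
    exact integrable_mul_expo (integrable_vecMul hG _ _) _
  simp only [h1]
  rw [integral_finsetSum _ fun j _ => (hi j).const_mul _]
  simp only [integral_const_mul, Finset.mul_sum, map_sum, scalarProd]
  refine Finset.sum_congr rfl fun j _ => ?_
  rw [← Prod.mk.eta (p := j), blockToeplitz_mulVec hG]
  simp only [map_mul, Complex.conj_conj]
  ring

/-- A kernel vector gives a polynomial of zero energy in an almost everywhere positive definite
weight. The polynomial vanishes almost everywhere, and its Fourier coefficients are the entries of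
the vector. -/
theorem isUnit_blockToeplitz (hG : IsWeight G) (hu : ∀ᵐ x ∂freq, IsUnit (G x).det) :
    IsUnit (blockToeplitz N K s G) := by
  rw [← Matrix.mulVec_injective_iff_isUnit]
  refine (injective_iff_map_eq_zero (Matrix.mulVecLin (blockToeplitz N K s G))).2 fun v hv => ?_
  have hm : MemL2 G (vecPoly N K s v) := by
    rw [vecPoly_eq_trigPoly]; exact memL2_trigPoly hG _
  have h1 := scalarProd_blockToeplitz (N := N) (K := K) hG.integrable v v
  rw [← Matrix.mulVecLin_apply, hv] at h1
  have h2 : ∫ x, quadForm G (vecPoly N K s v) x ∂freq = 0 := by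
    have h3 : ∫ x, sform (G x) (vecPoly N K s v x) (vecPoly N K s v x) ∂freq = 0 := by
      have h4 : (1 / (2 * Real.pi) : ℂ) ≠ 0 := by simp [Real.pi_ne_zero]
      have h5 : scalarProd v 0 = 0 := by simp [scalarProd]
      rw [h5, eq_comm, map_eq_zero, mul_eq_zero] at h1
      exact h1.resolve_left h4
    simp only [quadForm_eq]
    have := integral_re (𝕜 := ℂ) (hm.integrable_sform hG hm)
    rw [h3] at this
    simpa using this
  rw [integral_eq_zero_iff_of_nonneg_ae (quadForm_nonneg hG _) hm.2] at h2
  have h3 : ∀ᵐ x ∂freq, vecPoly N K s v x = 0 := by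
    filter_upwards [h2, hG.posSemidef, hu] with x hx1 hx2 hx3
    by_contra hne
    have h4 := (posDef_of_isUnit_det hx2 hx3).dotProduct_mulVec_pos (star_ne_zero.2 hne)
    rw [star_star] at h4
    have h5 := (Complex.lt_def.1 h4).1
    rw [quadForm_eq, sform] at hx1
    rw [hx1] at h5
    exact lt_irrefl _ h5
  ext ⟨k, ν⟩
  have h4 := integral_vecPoly_mul_expo (K := K) v k ν
  rw [integral_congr_ae (g := fun _ => 0) (h3.mono fun x hx => by simp [hx])] at h4
  simpa [Real.pi_ne_zero] using h4.symm

end Toeplitz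

/-! ### The spectral characteristic -/

section Characteristic

variable {N K : ℕ → ℕ} {s T : ℕ} {f g : ℝ → Matrix (Fin T) (Fin T) ℂ} (a : ℤ → Fin T → ℂ)

theorem norm_vecPoly_le (v : Pos N s × Fin T → ℂ) :
    ∃ C, ∀ x ν, ‖vecPoly N K s v x ν‖ ≤ C := by
  rw [vecPoly_eq_trigPoly]; exact ⟨_, norm_trigPoly_apply_le _⟩

theorem continuous_vecPoly (v : Pos N s × Fin T → ℂ) : Continuous (vecPoly N K s v) := by
  rw [vecPoly_eq_trigPoly]; exact continuous_trigPoly _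

theorem memL2_vecPoly (hf : IsWeight f) (v : Pos N s × Fin T → ℂ) :
    MemL2 f (vecPoly N K s v) := by
  rw [vecPoly_eq_trigPoly]; exact memL2_trigPoly hf _

theorem optChar_eq {x : ℝ} (h : IsUnit (f x + g x).det) :
    optChar N K s f g a x = vecPoly N K s (coeffVec N K s a) x -
        Matrix.vecMul (Matrix.vecMul (vecPoly N K s (coeffVec N K s a) x) (g x)
            + vecPoly N K s (solVec N K s f g a) x) (f x + g x)⁻¹ := by
  rw [optChar, eq_sub_iff_add_eq, ← Matrix.add_vecMul, sub_add_add_cancel, ← Matrix.vecMul_add,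
    Matrix.vecMul_vecMul, Matrix.mul_nonsing_inv _ h, Matrix.vecMul_one]

theorem memL2_optChar (hf : IsWeight f) (hg : IsWeight g)
    (hmin : Minimality fun x => f x + g x) :
    MemL2 (fun x => f x + g x) (optChar N K s f g a) := by
  have hF := hf.add hg
  have hm := (memL2_vecPoly (N := N) (K := K) (s := s) hf (coeffVec N K s a))
  have h1 : MemL2 (fun x => f x + g x) fun x => Matrix.vecMul (Matrix.vecMul
      (vecPoly N K s (coeffVec N K s a) x) (f x)) (f x + g x)⁻¹ := by
    refine .of_le hF (aestronglyMeasurable_vecMul (aestronglyMeasurable_vecMul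
      (continuous_vecPoly _).aestronglyMeasurable hf.aestronglyMeasurable)
      (hF.inv hmin).aestronglyMeasurable) hm.2 ?_
    filter_upwards [hf.posSemidef, hg.posSemidef, hmin.1] with x h1 h2 h3
    simp only [quadForm_eq]
    exact sform_vecMul_mul_inv_self_le h1 h2 h3 _
  obtain ⟨C, hC⟩ := norm_vecPoly_le (K := K) (solVec N K s f g a)
  have h2 := MemL2.vecMul_inv hF hmin (continuous_vecPoly _).aestronglyMeasurable hC
  have := h1.sub hF h2
  simpa only [← Matrix.sub_vecMul] using! this

/-- The system `B c = D a` says that `Cᵀ (f + g)⁻¹` and `Aᵀ f (f + g)⁻¹` have the same Fourier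
coefficients on `S`; their difference is the characteristic. -/
theorem memL2Minus_optChar (hf : IsWeight f) (hg : IsWeight g)
    (hmin : Minimality fun x => f x + g x) :
    MemL2Minus (fun x => f x + g x) (missing N K s) (optChar N K s f g a) := by
  have hF := hf.add hg
  have hG := hF.inv hmin
  rw [missing_eq]
  refine memL2Minus_of_integral_mul_expo_eq_zero hF hmin _ (memL2_optChar a hf hg hmin)
    fun j hj ν => ?_
  obtain ⟨k, -, rfl⟩ := Finset.mem_image.1 hj
  have hunit : IsUnit (blockToeplitz N K s (symbolB f g)) :=
    isUnit_blockToeplitz hG (hmin.1.mono fun x hx => Matrix.isUnit_nonsing_inv_det _ hx)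
  have hsol : (blockToeplitz N K s (symbolB f g)).mulVec (solVec N K s f g a) =
      (blockToeplitz N K s (symbolD f g)).mulVec (coeffVec N K s a) := by
    rw [solVec, Matrix.mulVec_mulVec, Matrix.mul_nonsing_inv _
      ((Matrix.isUnit_iff_isUnit_det _).1 hunit), Matrix.one_mulVec]
  have h1 := congrFun hsol (k, ν)
  rw [blockToeplitz_mulVec (G := symbolB f g) hG.integrable,
    blockToeplitz_mulVec (G := symbolD f g) (integrable_mul_inv hf hg hmin)] at h1
  have hpi : (1 / (2 * Real.pi) : ℂ) ≠ 0 := by simp [Real.pi_ne_zero]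
  have h2 := mul_left_cancel₀ hpi h1
  simp only [optChar, Matrix.sub_vecMul, Pi.sub_apply, sub_mul, Matrix.vecMul_vecMul]
  rw [integral_sub]
  · exact sub_eq_zero.2 h2.symm
  · rw [vecPoly_eq_trigPoly]
    exact integrable_mul_expo (integrable_vecMul (integrable_mul_inv hf hg hmin) _ _) _
  · rw [vecPoly_eq_trigPoly]
    exact integrable_mul_expo (integrable_vecMul hG.integrable _ _) _

theorem integral_vecPoly_dotProduct_eq_zero (hf : IsWeight f) (hmin : Minimality f)
    (v : Pos N s × Fin T → ℂ) {d : ℝ → Fin T → ℂ} (hd : MemL2Minus f (missing N K s) d) :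
    ∫ x, d x ⬝ᵥ star (vecPoly N K s v x) ∂freq = 0 := by
  have h1 : ∀ x, d x ⬝ᵥ star (vecPoly N K s v x) =
      ∑ ν, ∑ k : Pos N s, conj (v (k, ν)) * (d x ν * expo (-time N K k) x) := fun x => by
    rw [dotProduct]
    refine Finset.sum_congr rfl fun ν _ => ?_
    simp only [Pi.star_apply, vecPoly, star_sum, star_mul', Finset.mul_sum, Complex.star_def,
      conj_expo]
    exact Finset.sum_congr rfl fun _ _ => by ring
  have hi := fun ν (k : Pos N s) => (integrable_mul_expo (hd.1.integrable_coord hf hmin ν)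
    (-time N K k)).const_mul (conj (v (k, ν)))
  simp only [h1]
  rw [integral_finsetSum _ fun ν _ => integrable_finsetSum _ fun k _ => hi ν k]
  refine Finset.sum_eq_zero fun ν _ => ?_
  rw [integral_finsetSum _ fun k _ => hi ν k]
  refine Finset.sum_eq_zero fun k _ => ?_
  rw [integral_const_mul, hd.integral_mul_expo_eq_zero hf hmin (time_mem_missing N K s k),
    mul_zero]

theorem spectralMSE_eq (hf : IsWeight f) (hg : IsWeight g) {A h : ℝ → Fin T → ℂ}
    (hA : MemL2 f A) (hh : MemL2 (fun x => f x + g x) h) :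
    spectralMSE f g A h = 1 / (2 * Real.pi) *
      ∫ x, (quadForm f (fun x => A x - h x) x + quadForm g h x) ∂freq := by
  rw [spectralMSE, integral_add (hA.sub hf (hh.left hf hg)).2 (hh.right hf hg).2, mul_add]

/-- The mean square error exceeds the one of the spectral characteristic by the squared distance
to the spectral characteristic. -/
theorem spectralMSE_eq_add (hf : IsWeight f) (hg : IsWeight g)
    (hmin : Minimality fun x => f x + g x) {d : ℝ → Fin T → ℂ}
    (hd : MemL2Minus (fun x => f x + g x) (missing N K s) d) :
    spectralMSE f g (vecPoly N K s (coeffVec N K s a)) d =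
      spectralMSE f g (vecPoly N K s (coeffVec N K s a)) (optChar N K s f g a) +
      1 / (2 * Real.pi) * ∫ x, quadForm (fun x => f x + g x)
        (fun x => d x - optChar N K s f g a x) x ∂freq := by
  have hF := hf.add hg
  set A := vecPoly N K s (coeffVec N K s a)
  set C := vecPoly N K s (solVec N K s f g a)
  set h := optChar N K s f g a with hhdef
  have hh : MemL2Minus _ _ h := memL2Minus_optChar a hf hg hmin
  have hA : MemL2 f A := memL2_vecPoly hf _
  obtain ⟨B, hB⟩ := norm_vecPoly_le (K := K) (solVec N K s f g a)
  have hdi := hd.1.integrable_dotProduct hF hmin (continuous_vecPoly _).aestronglyMeasurable hB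
  have hhi := hh.1.integrable_dotProduct hF hmin (continuous_vecPoly _).aestronglyMeasurable hB
  -- This is the cross term of the expansion around `h`. Subtracting it as a vanishing integral
  -- reduces the claim to a pointwise identity.
  have hcr : ∫ x, 2 * ((d x ⬝ᵥ star (C x)) - h x ⬝ᵥ star (C x)).re ∂freq = 0 := by
    rw [integral_const_mul]
    have h1 : ∫ x, ((d x ⬝ᵥ star (C x)) - h x ⬝ᵥ star (C x)).re ∂freq =
        (∫ x, ((d x ⬝ᵥ star (C x)) - h x ⬝ᵥ star (C x)) ∂freq).re :=
      integral_re (𝕜 := ℂ) (hdi.sub hhi)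
    rw [h1, integral_sub hdi hhi, integral_vecPoly_dotProduct_eq_zero hF hmin _ hd,
      integral_vecPoly_dotProduct_eq_zero hF hmin _ hh]
    simp
  rw [spectralMSE_eq hf hg hA hd.1, spectralMSE_eq hf hg hA hh.1, ← mul_add]
  congr 1
  have hi1 : Integrable (fun x => quadForm f (fun x => A x - h x) x + quadForm g h x) freq :=
    (hA.sub hf (hh.1.left hf hg)).2.add (hh.1.right hf hg).2
  have hi2 := (hd.1.sub hF hh.1).2
  have hi3 : Integrable (fun x => 2 * ((d x ⬝ᵥ star (C x)) - h x ⬝ᵥ star (C x)).re) freq :=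
    (hdi.sub hhi).re.const_mul 2
  rw [← integral_add hi1 hi2]
  refine Eq.trans ?_ (sub_zero _)
  rw [← hcr]
  refine Eq.trans ?_ (integral_sub (hi1.add hi2) hi3)
  refine integral_congr_ae ?_
  filter_upwards [hf.posSemidef, hg.posSemidef, hmin.1] with x h1 h2 h3
  simp only [quadForm_eq]
  obtain ⟨e, he⟩ : ∃ e, d x = h x + e := ⟨d x - h x, by abel⟩
  -- The normal equation: it turns the part of the expansion linear in `e` into the pairing of `e`
  -- with `C`.
  have h4 : Matrix.vecMul (h x) (f x + g x) = Matrix.vecMul (A x) (f x) - C x := by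
    rw [hhdef, optChar, Matrix.vecMul_vecMul, Matrix.nonsing_inv_mul _ h3, Matrix.vecMul_one]
  have h5 : sform (f x) (h x) e + sform (g x) (h x) e = sform (f x) (A x) e - C x ⬝ᵥ star e := by
    rw [← sform_add_matrix, sform, Matrix.dotProduct_mulVec, h4, sub_dotProduct,
      ← Matrix.dotProduct_mulVec, sform]
  have h6 : e ⬝ᵥ star (C x) = conj (C x ⬝ᵥ star e) := by
    simp [dotProduct, mul_comm]
  have h7 := conj_sform h1.1 (h x) e
  have h8 := conj_sform h2.1 (h x) e
  have h9 := conj_sform h1.1 (A x) e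
  have h10 := congrArg Complex.re h5
  rw [he]
  simp only [add_sub_cancel_left, add_dotProduct, h6, sform_sub_left, sform_sub_right,
    sform_add_left, sform_add_right, sform_add_matrix, ← h7, ← h8, ← h9, Complex.add_re,
    Complex.sub_re, Complex.conj_re] at h10 ⊢
  linarith

/-- With the vectors of the proof, `A - h = u1 + u2`, `h = u3 - u2` and `u1 + u3 = A`. By the
parallel sum symmetry `f[u1, w]` and `g[u3, w]` both equal the form of `f (f + g)⁻¹ g` at `A, w`, so
the cross terms with `u2` cancel. -/
theorem sform_optimal {f g : Matrix (Fin T) (Fin T) ℂ} (hf : f.PosSemidef) (hg : g.PosSemidef)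
    (hu : IsUnit (f + g).det) (A C h : Fin T → ℂ)
    (hh : h = Matrix.vecMul (Matrix.vecMul A f - C) (f + g)⁻¹)
    (hh' : h = A - Matrix.vecMul (Matrix.vecMul A g + C) (f + g)⁻¹) :
    sform f (A - h) (A - h) + sform g h h =
      sform (f * (f + g)⁻¹ * g) A A + sform (f + g)⁻¹ C C := by
  set u1 := Matrix.vecMul (Matrix.vecMul A g) (f + g)⁻¹ with hu1
  set u2 := Matrix.vecMul C (f + g)⁻¹ with hu2
  set u3 := Matrix.vecMul (Matrix.vecMul A f) (f + g)⁻¹ with hu3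
  have e1 : A - h = u1 + u2 := by rw [hh', Matrix.add_vecMul]; abel
  have e2 : h = u3 - u2 := by rw [hh, Matrix.sub_vecMul]
  have e3 : u1 + u3 = A := by
    have := congrArg₂ (· + ·) e1 e2
    simp only [sub_add_cancel] at this
    rw [this]; abel
  have e4 : ∀ w, sform f u1 w = sform (f * (f + g)⁻¹ * g) A w := fun w => by
    rw [sform, Matrix.dotProduct_mulVec, hu1, Matrix.vecMul_vecMul, Matrix.vecMul_vecMul,
      ← Matrix.mul_assoc, mul_inv_mul_comm hu, ← Matrix.dotProduct_mulVec, sform]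
  have e5 : ∀ w, sform g u3 w = sform (f * (f + g)⁻¹ * g) A w := fun w => by
    rw [sform, Matrix.dotProduct_mulVec, hu3, Matrix.vecMul_vecMul, Matrix.vecMul_vecMul,
      ← Matrix.mul_assoc, ← Matrix.dotProduct_mulVec, sform]
  have e6 : sform f u2 u2 + sform g u2 u2 = sform (f + g)⁻¹ C C := by
    rw [← sform_add_matrix, hu2, sform_vecMul_inv_self (hf.add hg).1 hu]
  have e7 : sform f u2 u1 = sform g u2 u3 := by
    rw [← conj_sform hf.1, ← conj_sform hg.1, e4, e5]
  rw [e1, e2, ← e6]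
  conv_rhs => rw [← e3]
  simp only [sform_add_left, sform_add_right, sform_sub_left, sform_sub_right]
  simp only [← e3, sform_add_left] at e4 e5
  simp only [e4, e5, e7]
  ring

theorem spectralMSE_optChar (hf : IsWeight f) (hg : IsWeight g)
    (hmin : Minimality fun x => f x + g x) :
    ((spectralMSE f g (vecPoly N K s (coeffVec N K s a)) (optChar N K s f g a) : ℝ) : ℂ) =
      errorValue N K s f g a := by
  have hF := hf.add hg
  have hh := memL2_optChar (N := N) (K := K) (s := s) a hf hg hmin
  rw [errorValue, scalarProd_blockToeplitz (G := symbolR f g) (hf.mul_inv_mul hg hmin),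
    scalarProd_blockToeplitz (G := symbolB f g) (hF.inv hmin).integrable, ← map_add, ← mul_add, ← integral_add]
  · rw [spectralMSE_eq hf hg (memL2_vecPoly hf _) hh, ← Complex.conj_ofReal]
    congr 1
    push_cast
    congr 1
    rw [← integral_complex_ofReal]
    refine integral_congr_ae ?_
    filter_upwards [hf.posSemidef, hg.posSemidef, hmin.1] with x h1 h2 h3
    simp only [quadForm_eq]
    push_cast
    rw [← sform_self_eq_re h1, ← sform_self_eq_re h2]
    exact sform_optimal h1 h2 h3 _ _ _ rfl (optChar_eq a h3)
  · simp only [sform, Matrix.dotProduct_mulVec]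
    rw [vecPoly_eq_trigPoly]
    simp only [dotProduct]
    refine integrable_finsetSum _ fun ν _ => ?_
    exact (integrable_vecMul (hf.mul_inv_mul hg hmin) _ ν).mul_bdd
      (((continuous_apply ν).comp (continuous_trigPoly _)).star).aestronglyMeasurable
      (ae_of_all _ fun x => by
        simpa using norm_trigPoly_apply_le _ x ν)
  · exact (memL2_vecPoly (hF.inv hmin) _).integrable_sform (hF.inv hmin)
      (memL2_vecPoly (hF.inv hmin) _)

end Characteristic

/-! ### Linear functionals of a stationary sequence -/

theorem norm_sq_eq_integral {Ω : Type*} [MeasurableSpace Ω] {P : Measure Ω} (Z : Lp ℂ 2 P)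
    {u : Ω → ℂ} (hu : u =ᵐ[P] Z) : ∫ ω, ‖u ω‖ ^ 2 ∂P = ‖Z‖ ^ 2 := by
  conv_rhs => rw [← Lp.toLp_coeFn Z (Lp.memLp Z), norm_toLp_sq]
  exact integral_congr_ae (hu.mono fun ω h => by simp only [h])

section Sequences

variable {Ω : Type*} [MeasurableSpace Ω] {P : Measure Ω} {T : ℕ} {ξ η : ℤ → Ω → Fin T → ℂ}
  {f g : ℝ → Matrix (Fin T) (Fin T) ℂ}

theorem IsSpectralDensity.isWeight (hf : IsSpectralDensity P ξ f) : IsWeight f :=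
  ⟨hf.integrable, hf.posSemidef⟩

/-- The random variable `∑ⱼ p(j)ᵀ ξ(j)` as an element of `L²(P)`. -/
noncomputable def seqLp (hξ : ∀ n ν, MemLp (fun ω => ξ n ω ν) 2 P) : (ℤ →₀ (Fin T → ℂ)) →ₗ[ℂ] Lp ℂ 2 P :=
  Finsupp.lsum ℂ fun j => ∑ ν, (LinearMap.proj ν : (Fin T → ℂ) →ₗ[ℂ] ℂ).smulRight (hξ j ν).toLp

variable {hξ : ∀ n ν, MemLp (fun ω => ξ n ω ν) 2 P} {hη : ∀ n ν, MemLp (fun ω => η n ω ν) 2 P}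

theorem seqLp_single (j : ℤ) (v : Fin T → ℂ) :
    seqLp hξ (Finsupp.single j v) = ∑ ν, v ν • (hξ j ν).toLp := by
  simp [seqLp]

theorem seqLp_single_single (j : ℤ) (ν : Fin T) :
    seqLp hξ (Finsupp.single j (Pi.single ν 1)) = (hξ j ν).toLp := by
  rw [seqLp_single, Finset.sum_eq_single ν]
  · simp
  · intro μ _ hμ; simp [hμ]
  · simp

theorem seqLp_add_seqLp (hζ : ∀ n ν, MemLp (fun ω => (ξ n ω + η n ω) ν) 2 P)
    (p : ℤ →₀ (Fin T → ℂ)) :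
    seqLp (ξ := fun n ω => ξ n ω + η n ω) hζ p = seqLp hξ p + seqLp hη p := by
  induction p using Finsupp.induction_linear with
  | zero => simp
  | add p q hp hq => simp only [map_add, hp, hq]; abel
  | single j v =>
    simp only [seqLp_single, ← Finset.sum_add_distrib, ← smul_add]
    rfl

theorem inner_seqLp_single (j k : ℤ) (v w : Fin T → ℂ) :
    inner ℂ (seqLp hη (Finsupp.single k w)) (seqLp hξ (Finsupp.single j v)) =
      ∑ ν, ∑ μ, v ν * conj (w μ) * ∫ ω, ξ j ω ν * conj (η k ω μ) ∂P := by
  simp only [seqLp_single, sum_inner, inner_sum, inner_smul_left, inner_smul_right]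
  simp only [Finset.mul_sum]
  refine Finset.sum_congr rfl fun ν _ => Finset.sum_congr rfl fun μ _ => ?_
  rw [inner_toLp]
  simp only [RCLike.inner_apply]
  ring

theorem inner_seqLp_eq_zero (h : Uncorrelated P ξ η) (p q : ℤ →₀ (Fin T → ℂ)) :
    inner ℂ (seqLp hη q) (seqLp hξ p) = 0 := by
  induction p using Finsupp.induction_linear with
  | zero => simp
  | add p p' hp hp' => rw [map_add, inner_add_right, hp, hp', add_zero]
  | single j v =>
    induction q using Finsupp.induction_linear with
    | zero => simp
    | add p p' hp hp' => rw [map_add, inner_add_left, hp, hp', add_zero]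
    | single k w =>
      rw [inner_seqLp_single]
      simp [h j k]

theorem inner_seqLp (hf : IsSpectralDensity P ξ f) (p q : ℤ →₀ (Fin T → ℂ)) :
    inner ℂ (seqLp hξ q) (seqLp hξ p) = (1 / (2 * Real.pi) : ℂ) *
      ∫ x, sform (f x) (trigPoly p x) (trigPoly q x) ∂freq := by
  have hw := hf.isWeight
  have hi := fun p q : ℤ →₀ (Fin T → ℂ) =>
    (memL2_trigPoly hw p).integrable_sform hw (memL2_trigPoly hw q)
  induction p using Finsupp.induction_linear with
  | zero => simp [trigPoly_zero, sform]
  | add p p' hp hp' =>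
    rw [map_add, inner_add_right, hp, hp', ← mul_add, ← integral_add (hi _ _) (hi _ _)]
    simp only [trigPoly_add, sform_add_left]
  | single j v =>
    induction q using Finsupp.induction_linear with
    | zero => simp [trigPoly_zero, sform]
    | add p p' hp hp' =>
      rw [map_add, inner_add_left, hp, hp', ← mul_add, ← integral_add (hi _ _) (hi _ _)]
      simp only [trigPoly_add, sform_add_right]
    | single k w =>
      rw [inner_seqLp_single]
      simp only [hf.covariance]
      have h1 : ∀ x, sform (f x) (trigPoly (Finsupp.single j v) x)
          (trigPoly (Finsupp.single k w) x) =
          ∑ ν, ∑ μ, v ν * conj (w μ) * (f x ν μ * expo (j - k) x) := fun x => by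
        rw [sform_eq_sum]
        refine Finset.sum_congr rfl fun ν _ => Finset.sum_congr rfl fun μ _ => ?_
        simp only [trigPoly_single, Pi.smul_apply, smul_eq_mul, map_mul, conj_expo,
          sub_eq_add_neg, expo_add]
        ring
      have hi' := fun ν μ =>
        (integrable_mul_expo (hw.integrable ν μ) (j - k)).const_mul (v ν * conj (w μ))
      simp only [h1]
      rw [integral_finsetSum _ fun ν _ => integrable_finsetSum _ fun μ _ => hi' ν μ,
        Finset.mul_sum]
      refine Finset.sum_congr rfl fun ν _ => ?_
      rw [integral_finsetSum _ fun μ _ => hi' ν μ, Finset.mul_sum]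
      refine Finset.sum_congr rfl fun μ _ => ?_
      rw [integral_const_mul]
      have h2 : ∀ x : ℝ, Complex.exp (Complex.I * ((j - k : ℤ) : ℂ) * (x : ℂ)) * f x ν μ =
        f x ν μ * expo (j - k) x := fun x => mul_comm _ _
      simp only [h2]
      ring

theorem norm_seqLp_sq (hf : IsSpectralDensity P ξ f) (p : ℤ →₀ (Fin T → ℂ)) :
    ‖seqLp hξ p‖ ^ 2 = 1 / (2 * Real.pi) * ∫ x, quadForm f (trigPoly p) x ∂freq := by
  have hw := hf.isWeight
  have h := inner_seqLp (hξ := hξ) hf p p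
  have h1 : ∫ x, sform (f x) (trigPoly p x) (trigPoly p x) ∂freq =
      ((∫ x, quadForm f (trigPoly p) x ∂freq : ℝ) : ℂ) := by
    rw [← integral_complex_ofReal]
    refine integral_congr_ae ?_
    filter_upwards [hw.posSemidef] with x hx
    rw [quadForm_eq, ← sform_self_eq_re hx]
  rw [h1, inner_self_eq_norm_sq_to_K] at h
  simp only [Complex.coe_algebraMap] at h
  exact_mod_cast h

/-- The mean square error of a finite linear estimate. -/
theorem norm_seqLp_sub_sq (hf : IsSpectralDensity P ξ f) (hg : IsSpectralDensity P η g)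
    (hη : ∀ n ν, MemLp (fun ω => η n ω ν) 2 P) (h : Uncorrelated P ξ η)
    (hζ : ∀ n ν, MemLp (fun ω => (ξ n ω + η n ω) ν) 2 P) (q p : ℤ →₀ (Fin T → ℂ)) :
    ‖seqLp hξ q - seqLp (ξ := fun n ω => ξ n ω + η n ω) hζ p‖ ^ 2 =
      spectralMSE f g (trigPoly q) (trigPoly p) := by
  -- The error splits into a part in `ξ` and a part in `η`, which are orthogonal and give the two
  -- terms of `spectralMSE`.
  have h1 : seqLp hξ q - seqLp (ξ := fun n ω => ξ n ω + η n ω) hζ p =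
      seqLp hξ (q - p) - seqLp hη p := by
    rw [seqLp_add_seqLp (hξ := hξ) (hη := hη), map_sub]; abel
  rw [h1, @norm_sub_sq ℂ, inner_eq_zero_symm.1 (inner_seqLp_eq_zero h _ _), norm_seqLp_sq hf,
    norm_seqLp_sq hg, spectralMSE]
  simp only [map_zero, mul_zero, sub_zero]
  congr 4
  ext x
  simp [quadForm, trigPoly_sub]

theorem seqLp_mem_span (S : Set ℤ) {p : ℤ →₀ (Fin T → ℂ)} (hp : ∀ j ∈ p.support, j ∉ S) :
    seqLp hξ p ∈
      Submodule.span ℂ {X : Lp ℂ 2 P | ∃ j, j ∉ S ∧ ∃ ν, X =ᵐ[P] fun ω => ξ j ω ν} := by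
  rw [← Finsupp.sum_single p, Finsupp.sum, map_sum]
  refine Submodule.sum_mem _ fun j hj => ?_
  rw [seqLp_single]
  exact Submodule.sum_mem _ fun ν _ => Submodule.smul_mem _ _
    (Submodule.subset_span ⟨j, hp j hj, ν, (hξ j ν).coeFn_toLp⟩)

theorem exists_seqLp_eq (S : Set ℤ) {Y : Lp ℂ 2 P}
    (hY : Y ∈ Submodule.span ℂ {X : Lp ℂ 2 P | ∃ j, j ∉ S ∧ ∃ ν, X =ᵐ[P] fun ω => ξ j ω ν}) :
    ∃ p : ℤ →₀ (Fin T → ℂ), (∀ j ∈ p.support, j ∉ S) ∧ seqLp hξ p = Y := by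
  have hle : Submodule.span ℂ {X : Lp ℂ 2 P | ∃ j, j ∉ S ∧ ∃ ν, X =ᵐ[P] fun ω => ξ j ω ν} ≤
      (Finsupp.supported (Fin T → ℂ) ℂ Sᶜ).map (seqLp hξ) := by
    rw [Submodule.span_le]
    rintro X ⟨j, hj, ν, hX⟩
    refine ⟨Finsupp.single j (Pi.single ν 1), Finsupp.single_mem_supported ℂ _ hj, ?_⟩
    rw [seqLp_single_single]
    exact Lp.ext ((hξ j ν).coeFn_toLp.trans hX.symm)
  obtain ⟨p, hp, rfl⟩ := hle hY
  exact ⟨p, fun j hj => hp hj, rfl⟩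

end Sequences

/-! ### The optimal linear estimate -/

section Estimate

variable {Ω : Type*} [MeasurableSpace Ω] {P : Measure Ω} {N K : ℕ → ℕ} {s T : ℕ}
  {ξ η : ℤ → Ω → Fin T → ℂ} {f g : ℝ → Matrix (Fin T) (Fin T) ℂ} (a : ℤ → Fin T → ℂ)

/-- The coefficients of the functional `A_s ξ`. -/
noncomputable def functionalCoeff (N K : ℕ → ℕ) (s : ℕ) (a : ℤ → Fin T → ℂ) : ℤ →₀ (Fin T → ℂ) :=
  ∑ k : Pos N s, Finsupp.single (time N K k) fun ν => coeffVec N K s a (k, ν)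

theorem seqLp_functionalCoeff (hξ : ∀ n ν, MemLp (fun ω => ξ n ω ν) 2 P) :
    functional N K s a ξ =ᵐ[P] seqLp hξ (functionalCoeff N K s a) := by
  have h1 : seqLp hξ (functionalCoeff N K s a) =
      ∑ k : Pos N s, ∑ ν, (a (time N K k) ν) • (hξ (time N K k) ν).toLp := by
    simp only [functionalCoeff, map_sum, seqLp_single, coeffVec]
  rw [h1]
  filter_upwards [Lp.coeFn_finsetSum Finset.univ fun k : Pos N s =>
      ∑ ν, (a (time N K k) ν) • (hξ (time N K k) ν).toLp,
    ae_all_iff.2 fun k : Pos N s => Lp.coeFn_finsetSum Finset.univ fun ν =>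
      (a (time N K k) ν) • (hξ (time N K k) ν).toLp,
    ae_all_iff.2 fun k : Pos N s => ae_all_iff.2 fun ν =>
      Lp.coeFn_smul (a (time N K k) ν) (hξ (time N K k) ν).toLp,
    ae_all_iff.2 fun k : Pos N s => ae_all_iff.2 fun ν => (hξ (time N K k) ν).coeFn_toLp]
    with ω h2 h3 h4 h5
  rw [h2, functional_eq]
  simp only [Finset.sum_apply, h3, h4, h5, Pi.smul_apply, smul_eq_mul]

/-- The last clause links `X` to the characteristic through polynomials alone, without constructing
the isometry between the observed subspace and `L₂^{s-}(f + g)`. -/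
theorem exists_projection (hξ : ∀ n ν, MemLp (fun ω => ξ n ω ν) 2 P)
    (hη : ∀ n ν, MemLp (fun ω => η n ω ν) 2 P)
    (hf : IsSpectralDensity P ξ f) (hg : IsSpectralDensity P η g)
    (h : Uncorrelated P ξ η) (hζ : ∀ n ν, MemLp (fun ω => (ξ n ω + η n ω) ν) 2 P)
    (hmin : Minimality fun x => f x + g x) :
    ∃ X ∈ observed P (fun j ω => ξ j ω + η j ω) (missing N K s),
      (∀ Y ∈ observed P (fun j ω => ξ j ω + η j ω) (missing N K s),
        ‖seqLp hξ (functionalCoeff N K s a) - Y‖ ^ 2 =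
          ‖seqLp hξ (functionalCoeff N K s a) - X‖ ^ 2 + ‖X - Y‖ ^ 2) ∧
      ‖seqLp hξ (functionalCoeff N K s a) - X‖ ^ 2 =
        spectralMSE f g (vecPoly N K s (coeffVec N K s a)) (optChar N K s f g a) ∧
      ∀ p : ℤ →₀ (Fin T → ℂ), (∀ j ∈ p.support, j ∉ missing N K s) →
        ‖X - seqLp (ξ := fun n ω => ξ n ω + η n ω) hζ p‖ ^ 2 =
          1 / (2 * Real.pi) * ∫ x, quadForm (fun x => f x + g x)
            (fun x => trigPoly p x - optChar N K s f g a x) x ∂freq := by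
  have hwf := hf.isWeight
  have hwg := hg.isWeight
  have hF := hwf.add hwg
  set H := observed P (fun j ω => ξ j ω + η j ω) (missing N K s) with hH
  set A := seqLp hξ (functionalCoeff N K s a)
  set m := spectralMSE f g (vecPoly N K s (coeffVec N K s a)) (optChar N K s f g a)
  have hHc : IsClosed (H : Set (Lp ℂ 2 P)) := Submodule.isClosed_topologicalClosure _
  have : CompleteSpace H := hHc.completeSpace_coe
  set X := H.starProjection A
  have hX : X ∈ H := Submodule.starProjection_apply_mem _ _
  have hpyth : ∀ Y ∈ H, ‖A - Y‖ ^ 2 = ‖A - X‖ ^ 2 + ‖X - Y‖ ^ 2 := by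
    intro Y hY
    have h1 : inner ℂ (A - X) (X - Y) = 0 :=
      Submodule.starProjection_inner_eq_zero A (X - Y) (H.sub_mem hX hY)
    have h2 : A - Y = (A - X) + (X - Y) := by abel
    rw [h2, @norm_add_sq ℂ, h1]
    simp
  have hpoly : ∀ p : ℤ →₀ (Fin T → ℂ), (∀ j ∈ p.support, j ∉ missing N K s) →
      seqLp (ξ := fun n ω => ξ n ω + η n ω) hζ p ∈ H ∧
      ‖A - seqLp (ξ := fun n ω => ξ n ω + η n ω) hζ p‖ ^ 2 = m + 1 / (2 * Real.pi) *
        ∫ x, quadForm (fun x => f x + g x)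
          (fun x => trigPoly p x - optChar N K s f g a x) x ∂freq := by
    intro p hp
    refine ⟨Submodule.le_topologicalClosure _ (seqLp_mem_span _ hp), ?_⟩
    have hpm : MemL2Minus (fun x => f x + g x) (missing N K s) (trigPoly p) :=
      ⟨memL2_trigPoly hF p, fun ε hε => ⟨p, hp, by simpa [quadForm] using hε⟩⟩
    rw [norm_seqLp_sub_sq hf hg hη h, ← spectralMSE_eq_add a hwf hwg hmin hpm,
      vecPoly_eq_trigPoly]
    rfl
  have hnn : ∀ d, 0 ≤ 1 / (2 * Real.pi) * ∫ x, quadForm (fun x => f x + g x) d x ∂freq :=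
    fun d => mul_nonneg (by positivity) (integral_quadForm_nonneg hF d)
  -- The bound holds on the span of the observations and passes to its closure; the reverse bound
  -- uses polynomials approximating the characteristic.
  have hge : m ≤ ‖A - X‖ ^ 2 := by
    have hcl : IsClosed {Y : Lp ℂ 2 P | m ≤ ‖A - Y‖ ^ 2} :=
      isClosed_le continuous_const (by fun_prop)
    refine (closure_minimal (fun Y hY => ?_) hcl) (show X ∈ closure _ from hX)
    obtain ⟨p, hp, rfl⟩ := exists_seqLp_eq (ξ := fun n ω => ξ n ω + η n ω) (hξ := hζ) _ hY
    rw [Set.mem_ofPred_eq, (hpoly p hp).2]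
    linarith [hnn fun x => trigPoly p x - optChar N K s f g a x]
  have hle : ‖A - X‖ ^ 2 ≤ m := by
    refine le_of_forall_pos_le_add fun ε hε => ?_
    obtain ⟨p, hp, hpε⟩ := (memL2Minus_optChar (N := N) (K := K) (s := s) a hwf hwg hmin).2
      (2 * Real.pi * ε) (by positivity)
    have h1 := (hpoly p hp).2
    have h2 := hpyth _ (hpoly p hp).1
    have h3 : ∫ x, quadForm (fun x => f x + g x)
          (fun x => trigPoly p x - optChar N K s f g a x) x ∂freq < 2 * Real.pi * ε := by
      refine lt_of_eq_of_lt (integral_congr_ae (ae_of_all _ fun x => ?_)) hpε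
      simp only [quadForm_eq, sform_sub_left, sform_sub_right]
      congr 1
      ring
    have h4 : 1 / (2 * Real.pi) * ∫ x, quadForm (fun x => f x + g x)
          (fun x => trigPoly p x - optChar N K s f g a x) x ∂freq ≤ ε := by
      rw [one_div_mul_eq_div, div_le_iff₀ (by positivity), mul_comm ε]
      exact h3.le
    nlinarith [sq_nonneg ‖X - seqLp (ξ := fun n ω => ξ n ω + η n ω) hζ p‖]
  have heq := le_antisymm hle hge
  refine ⟨X, hX, hpyth, heq, fun p hp => ?_⟩
  have h1 := (hpoly p hp).2
  rw [hpyth _ (hpoly p hp).1, heq] at h1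
  exact add_left_cancel h1

end Estimate

/-! ### Approximation by simple functions -/

section Simple

variable {T : ℕ} {f g : ℝ → Matrix (Fin T) (Fin T) ℂ}

theorem memL2_simpleFunc (hf : IsWeight f) (φ : SimpleFunc ℝ (Fin T → ℂ)) : MemL2 f φ := by
  obtain ⟨C, hC⟩ := φ.exists_forall_norm_le
  exact .of_bounded hf φ.aestronglyMeasurable fun x ν => (norm_le_pi_norm _ ν).trans (hC x)

/-- The approximation is pointwise and uniformly bounded, so one sequence serves every weight. This
lets the integrals against both random measures use the same simple functions. -/
theorem exists_tendsto_simpleFunc {b : ℝ → Fin T → ℂ} (hb : Continuous b) {C : ℝ}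
    (hC : ∀ x, ‖b x‖ ≤ C) :
    ∃ φ : ℕ → SimpleFunc ℝ (Fin T → ℂ), ∀ f : ℝ → Matrix (Fin T) (Fin T) ℂ, IsWeight f →
      Tendsto (fun n => ∫ x, quadForm f (fun x => b x - φ n x) x ∂freq) atTop (𝓝 0) := by
  let φ := SimpleFunc.approxOn b hb.measurable Set.univ 0 trivial
  refine ⟨φ, fun f hf => ?_⟩
  have hz : ∫ x, quadForm f (fun _ => 0) x ∂freq = 0 := by simp [quadForm]
  rw [← hz]
  -- The `3 * C` comes from `‖b x‖ ≤ C` and the bound `2 * ‖b x‖` on the approximants.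
  refine tendsto_integral_of_dominated_convergence (fun x => (3 * C) ^ 2 * ∑ ν, ∑ μ, ‖f x ν μ‖)
    (fun n => aestronglyMeasurable_quadForm hf.aestronglyMeasurable
      (hb.aestronglyMeasurable.sub (φ n).aestronglyMeasurable))
    (hf.integrable_sum_norm.const_mul _) (fun n => ?_) ?_
  · filter_upwards [quadForm_nonneg hf fun x => b x - φ n x] with x hx
    rw [Real.norm_of_nonneg hx]
    refine quadForm_le_of_norm_le fun ν => (norm_le_pi_norm (b x - φ n x) ν).trans ?_
    have := SimpleFunc.norm_approxOn_zero_le hb.measurable (s := Set.univ) trivial x n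
    linarith [norm_sub_le (b x) (φ n x), hC x]
  · refine ae_of_all _ fun x => ?_
    have h1 : Tendsto (fun n => b x - φ n x) atTop (𝓝 0) := by
      have := (SimpleFunc.tendsto_approxOn hb.measurable (s := Set.univ) (y₀ := 0) trivial
        (x := x) (by simp)).const_sub (b x)
      rwa [sub_self] at this
    have h2 : Continuous fun v : Fin T → ℂ => (∑ ν, ∑ μ, v ν * f x ν μ * conj (v μ)).re := by
      fun_prop
    exact (h2.tendsto 0).comp h1

end Simple

/-! ### Integrals with respect to a random measure -/

section RandomMeasure

variable {Ω : Type*} [MeasurableSpace Ω] {P : Measure Ω} {T : ℕ} {Z : Set ℝ → Ω → Fin T → ℂ}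
  {ξ : ℤ → Ω → Fin T → ℂ} {f : ℝ → Matrix (Fin T) (Fin T) ℂ}

open Classical in
/-- The vector measure `Δ ↦ (v ↦ vᵀ Z(Δ))` with values in `L²(P)`. -/
noncomputable def measureLp (hm : ∀ Δ, MeasurableSet Δ → Δ ⊆ Set.Ioc (-Real.pi) Real.pi →
    ∀ ν, MemLp (fun ω => Z Δ ω ν) 2 P) (Δ : Set ℝ) : (Fin T → ℂ) →L[ℝ] Lp ℂ 2 P :=
  if h : MeasurableSet Δ then
    (∑ ν, (ContinuousLinearMap.proj (R := ℂ) (φ := fun _ : Fin T => ℂ) ν).smulRight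
      (hm (Δ ∩ Set.Ioc (-Real.pi) Real.pi) (h.inter measurableSet_Ioc)
        Set.inter_subset_right ν).toLp).restrictScalars ℝ
  else 0

variable {hm : ∀ Δ, MeasurableSet Δ → Δ ⊆ Set.Ioc (-Real.pi) Real.pi →
    ∀ ν, MemLp (fun ω => Z Δ ω ν) 2 P}

theorem measureLp_apply {Δ : Set ℝ} (h : MeasurableSet Δ) (v : Fin T → ℂ) :
    measureLp hm Δ v = ∑ ν, v ν • (hm (Δ ∩ Set.Ioc (-Real.pi) Real.pi)
      (h.inter measurableSet_Ioc) Set.inter_subset_right ν).toLp := by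
  rw [measureLp, dif_pos h]
  simp

/-- `measureLp` is bundled as real linear only; this supplies the complex homogeneity that
`simpleIntegralLp_smul` needs. -/
theorem measureLp_smul (c : ℂ) (Δ : Set ℝ) (v : Fin T → ℂ) :
    measureLp hm Δ (c • v) = c • measureLp hm Δ v := by
  by_cases h : MeasurableSet Δ
  · simp [measureLp_apply h, Finset.smul_sum, mul_smul]
  · simp [measureLp, dif_neg h]

theorem finMeasAdditive_measureLp (hZ : IsRandomSpectralMeasure P ξ f Z) :
    FinMeasAdditive freq (measureLp hZ.memLp) := by
  intro Δ Δ' h h' _ _ hd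
  ext1 v
  rw [_root_.add_apply, measureLp_apply h, measureLp_apply h', measureLp_apply (h.union h'),
    ← Finset.sum_add_distrib]
  refine Finset.sum_congr rfl fun ν _ => ?_
  rw [← smul_add, ← MemLp.toLp_add]
  congr 1
  rw [MemLp.toLp_eq_toLp_iff]
  have := hZ.additive (Δ ∩ Set.Ioc (-Real.pi) Real.pi) (Δ' ∩ Set.Ioc (-Real.pi) Real.pi)
    (h.inter measurableSet_Ioc) Set.inter_subset_right (h'.inter measurableSet_Ioc)
    Set.inter_subset_right (hd.mono Set.inter_subset_left Set.inter_subset_left)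
  rw [← Set.union_inter_distrib_right] at this
  filter_upwards [this] with ω hω
  simp [hω]

/-- The integral of a simple function as an element of `L²(P)`. -/
noncomputable def simpleIntegralLp (hm : ∀ Δ, MeasurableSet Δ → Δ ⊆ Set.Ioc (-Real.pi) Real.pi →
    ∀ ν, MemLp (fun ω => Z Δ ω ν) 2 P) (φ : SimpleFunc ℝ (Fin T → ℂ)) : Lp ℂ 2 P :=
  φ.setToSimpleFunc (measureLp hm)

theorem coeFn_simpleIntegralLp (φ : SimpleFunc ℝ (Fin T → ℂ)) :
    simpleIntegralLp hm φ =ᵐ[P] simpleIntegral Z φ := by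
  have h1 : simpleIntegralLp hm φ = ∑ v ∈ φ.range, ∑ ν, v ν •
      (hm (φ ⁻¹' {v} ∩ Set.Ioc (-Real.pi) Real.pi)
        ((φ.measurableSet_fiber v).inter measurableSet_Ioc) Set.inter_subset_right ν).toLp :=
    Finset.sum_congr rfl fun v _ => measureLp_apply (φ.measurableSet_fiber v) v
  rw [h1]
  refine (Lp.coeFn_fun_finsetSum _ _).trans ?_
  have h2 : ∀ v : Fin T → ℂ, ∀ᵐ ω ∂P, (∑ ν, v ν •
      (hm (φ ⁻¹' {v} ∩ Set.Ioc (-Real.pi) Real.pi)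
        ((φ.measurableSet_fiber v).inter measurableSet_Ioc) Set.inter_subset_right ν).toLp :
        Lp ℂ 2 P) ω = ∑ ν, v ν * Z (φ ⁻¹' {v} ∩ Set.Ioc (-Real.pi) Real.pi) ω ν := by
    intro v
    have hmv := hm (φ ⁻¹' {v} ∩ Set.Ioc (-Real.pi) Real.pi)
        ((φ.measurableSet_fiber v).inter measurableSet_Ioc) Set.inter_subset_right
    filter_upwards [Lp.coeFn_fun_finsetSum Finset.univ fun ν => v ν • (hmv ν).toLp,
      ae_all_iff.2 fun ν => Lp.coeFn_smul (v ν) (hmv ν).toLp,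
      ae_all_iff.2 fun ν => (hmv ν).coeFn_toLp] with ω h3 h4 h5
    rw [h3]
    exact Finset.sum_congr rfl fun ν _ => by rw [h4, Pi.smul_apply, h5, smul_eq_mul]
  filter_upwards [(Finset.eventually_all φ.range).2 fun v _ => h2 v] with ω hω
  exact Finset.sum_congr rfl hω

theorem inner_measureLp (hZ : IsRandomSpectralMeasure P ξ f Z)
    (hf : IsWeight f) {Δ Δ' : Set ℝ} (h : MeasurableSet Δ)
    (h' : MeasurableSet Δ') (v w : Fin T → ℂ) :
    inner ℂ (measureLp hZ.memLp Δ' w) (measureLp hZ.memLp Δ v) = (1 / (2 * Real.pi) : ℂ) *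
      ∫ x in Δ ∩ Δ', sform (f x) v w ∂freq := by
  rw [measureLp_apply h, measureLp_apply h']
  simp only [sum_inner, inner_sum, inner_smul_left, inner_smul_right, Finset.mul_sum, inner_toLp,
    sform_eq_sum]
  have hi : ∀ ν μ, IntegrableOn (fun x => v ν * f x ν μ * conj (w μ)) (Δ ∩ Δ') freq :=
    fun ν μ => (((hf.integrable ν μ).const_mul _).mul_const _).integrableOn
  rw [integral_finsetSum _ fun ν _ => integrable_finsetSum _ fun μ _ => hi ν μ, Finset.mul_sum]
  refine Finset.sum_congr rfl fun ν _ => ?_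
  rw [integral_finsetSum _ fun μ _ => hi ν μ, Finset.mul_sum]
  refine Finset.sum_congr rfl fun μ _ => ?_
  have h1 := hZ.orthogonal (Δ ∩ Set.Ioc (-Real.pi) Real.pi) (Δ' ∩ Set.Ioc (-Real.pi) Real.pi)
    (h.inter measurableSet_Ioc) Set.inter_subset_right (h'.inter measurableSet_Ioc)
    Set.inter_subset_right ν μ
  simp only [RCLike.inner_apply]
  rw [h1, integral_mul_const, integral_const_mul, freq, Measure.restrict_restrict (h.inter h'),
    ← Set.inter_inter_distrib_right]
  ring

/-- The isometry of the stochastic integral: fibres over distinct values are disjoint, so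
orthogonality leaves only the diagonal terms. -/
theorem norm_simpleIntegralLp_sq (hZ : IsRandomSpectralMeasure P ξ f Z)
    (hf : IsWeight f) (φ : SimpleFunc ℝ (Fin T → ℂ)) :
    ‖simpleIntegralLp hZ.memLp φ‖ ^ 2 = 1 / (2 * Real.pi) * ∫ x, quadForm f φ x ∂freq := by
  have h1 : inner ℂ (simpleIntegralLp hZ.memLp φ) (simpleIntegralLp hZ.memLp φ) =
      (1 / (2 * Real.pi) : ℂ) * ∫ x, sform (f x) (φ x) (φ x) ∂freq := by
    have h2 : ∀ x, sform (f x) (φ x) (φ x) =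
        ∑ v ∈ φ.range, (φ ⁻¹' {v}).indicator (fun x => sform (f x) v v) x := by
      intro x
      rw [Finset.sum_eq_single (φ x)]
      · rw [Set.indicator_of_mem (by simp)]
      · intro v _ hv
        exact Set.indicator_of_notMem (fun h => hv (by simpa using h.symm)) _
      · exact fun h => absurd (SimpleFunc.mem_range_self φ x) h
    have hi : ∀ v, Integrable (fun x => sform (f x) v v) freq := fun v =>
      have hv : MemL2 f fun _ => v := .of_bounded hf aestronglyMeasurable_const
        fun _ ν => norm_le_pi_norm v ν
      hv.integrable_sform hf hv
    simp only [h2]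
    rw [integral_finsetSum _ fun v _ => (hi v).indicator (φ.measurableSet_fiber v),
      Finset.mul_sum, simpleIntegralLp, SimpleFunc.setToSimpleFunc, inner_sum]
    refine Finset.sum_congr rfl fun v hv => ?_
    rw [sum_inner, Finset.sum_eq_single v]
    · rw [inner_measureLp hZ hf (φ.measurableSet_fiber v) (φ.measurableSet_fiber v),
        Set.inter_self, integral_indicator (φ.measurableSet_fiber v)]
    · intro w _ hw
      have hempty : φ ⁻¹' {v} ∩ φ ⁻¹' {w} = ∅ := by
        ext x
        simp only [Set.mem_inter_iff, Set.mem_preimage, Set.mem_singleton_iff,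
          Set.mem_empty_iff_false, iff_false, not_and]
        exact fun h1 h2 => hw (h2.symm.trans h1)
      rw [inner_measureLp hZ hf (φ.measurableSet_fiber v) (φ.measurableSet_fiber w), hempty]
      simp
    · exact fun h => absurd hv h
  have h3 : ∫ x, sform (f x) (φ x) (φ x) ∂freq = ((∫ x, quadForm f φ x ∂freq : ℝ) : ℂ) := by
    rw [← integral_complex_ofReal]
    refine integral_congr_ae ?_
    filter_upwards [hf.posSemidef] with x hx
    rw [quadForm_eq, ← sform_self_eq_re hx]
  rw [h3, inner_self_eq_norm_sq_to_K] at h1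
  simp only [Complex.coe_algebraMap] at h1
  exact_mod_cast h1

theorem simpleIntegralLp_sub (hZ : IsRandomSpectralMeasure P ξ f Z)
    (φ ψ : SimpleFunc ℝ (Fin T → ℂ)) :
    simpleIntegralLp hZ.memLp (φ - ψ) =
      simpleIntegralLp hZ.memLp φ - simpleIntegralLp hZ.memLp ψ :=
  SimpleFunc.setToSimpleFunc_sub _ (finMeasAdditive_measureLp hZ)
    (SimpleFunc.integrable_of_isFiniteMeasure φ) (SimpleFunc.integrable_of_isFiniteMeasure ψ)

theorem simpleIntegralLp_add (hZ : IsRandomSpectralMeasure P ξ f Z)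
    (φ ψ : SimpleFunc ℝ (Fin T → ℂ)) :
    simpleIntegralLp hZ.memLp (φ + ψ) =
      simpleIntegralLp hZ.memLp φ + simpleIntegralLp hZ.memLp ψ :=
  SimpleFunc.setToSimpleFunc_add _ (finMeasAdditive_measureLp hZ)
    (SimpleFunc.integrable_of_isFiniteMeasure φ) (SimpleFunc.integrable_of_isFiniteMeasure ψ)

theorem simpleIntegralLp_smul (hZ : IsRandomSpectralMeasure P ξ f Z)
    (c : ℂ) (φ : SimpleFunc ℝ (Fin T → ℂ)) :
    simpleIntegralLp hZ.memLp (c • φ) = c • simpleIntegralLp hZ.memLp φ :=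
  SimpleFunc.setToSimpleFunc_smul _ (finMeasAdditive_measureLp hZ) measureLp_smul c
    (SimpleFunc.integrable_of_isFiniteMeasure φ)

end RandomMeasure

/-! ### Passage from simple functions to `L₂` limits -/

section StochasticIntegral

variable {Ω : Type*} [MeasurableSpace Ω] {P : Measure Ω} {T : ℕ} {Z : Set ℝ → Ω → Fin T → ℂ}
  {ξ : ℤ → Ω → Fin T → ℂ} {f : ℝ → Matrix (Fin T) (Fin T) ℂ}

theorem tendsto_integral_quadForm_sub (hf : IsWeight f) {b d : ℕ → ℝ → Fin T → ℂ}
    (hb : ∀ n, MemL2 f (b n)) (hd : ∀ n, MemL2 f (d n))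
    (hb0 : Tendsto (fun n => ∫ x, quadForm f (b n) x ∂freq) atTop (𝓝 0))
    (hd0 : Tendsto (fun n => ∫ x, quadForm f (d n) x ∂freq) atTop (𝓝 0)) :
    Tendsto (fun n => ∫ x, quadForm f (fun x => b n x - d n x) x ∂freq) atTop (𝓝 0) := by
  refine squeeze_zero (fun n => integral_quadForm_nonneg hf _)
    (fun n => integral_quadForm_sub_le hf (hb n) (hd n)) ?_
  simpa using (hb0.const_mul 2).add (hd0.const_mul 2)

/-- Approximation in `L₂(f)` by simple functions implies convergence of the integrals. -/
theorem tendsto_simpleIntegralLp_of_tendsto (hZ : IsRandomSpectralMeasure P ξ f Z)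
    (hf : IsWeight f) {b : ℝ → Fin T → ℂ} (hb : MemL2 f b)
    {φ ψ : ℕ → SimpleFunc ℝ (Fin T → ℂ)} {Y : Lp ℂ 2 P}
    (hφ : Tendsto (fun n => ∫ x, quadForm f (fun x => b x - φ n x) x ∂freq) atTop (𝓝 0))
    (hψ : Tendsto (fun n => ∫ x, quadForm f (fun x => b x - ψ n x) x ∂freq) atTop (𝓝 0))
    (hφY : Tendsto (fun n => simpleIntegralLp hZ.memLp (φ n)) atTop (𝓝 Y)) :
    Tendsto (fun n => simpleIntegralLp hZ.memLp (ψ n)) atTop (𝓝 Y) := by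
  have h1 : Tendsto (fun n => ‖simpleIntegralLp hZ.memLp (φ n - ψ n)‖ ^ 2) atTop (𝓝 0) := by
    simp only [norm_simpleIntegralLp_sq hZ hf]
    have := (tendsto_integral_quadForm_sub hf
      (fun n => hb.sub hf (memL2_simpleFunc hf (ψ n)))
      (fun n => hb.sub hf (memL2_simpleFunc hf (φ n))) hψ hφ).const_mul (1 / (2 * Real.pi))
    rw [mul_zero] at this
    refine this.congr fun n => ?_
    simp only [sub_sub_sub_cancel_left]
    rfl
  have h2 : Tendsto (fun n => ‖simpleIntegralLp hZ.memLp (φ n - ψ n)‖) atTop (𝓝 0) := by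
    simpa using h1.sqrt
  have h3 := hφY.sub (tendsto_zero_iff_norm_tendsto_zero.2 h2)
  simp only [simpleIntegralLp_sub hZ, sub_sub_cancel, sub_zero] at h3
  exact h3

/-- `∑ⱼ p(j)ᵀ ξ(j)` is the integral of the trigonometric polynomial with coefficients `p` with
respect to the random measure. -/
theorem exists_tendsto_simpleIntegralLp (hZ : IsRandomSpectralMeasure P ξ f Z) (hf : IsWeight f)
    (hξ : ∀ n ν, MemLp (fun ω => ξ n ω ν) 2 P) (p : ℤ →₀ (Fin T → ℂ)) :
    ∃ φ : ℕ → SimpleFunc ℝ (Fin T → ℂ),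
      Tendsto (fun n => ∫ x, quadForm f (fun x => trigPoly p x - φ n x) x ∂freq) atTop (𝓝 0) ∧
      Tendsto (fun n => simpleIntegralLp hZ.memLp (φ n)) atTop (𝓝 (seqLp hξ p)) := by
  -- The polynomials with the required approximation form a subspace, so it suffices to treat the
  -- generators, where `hZ.representation` supplies the sequence.
  let V : Submodule ℂ (ℤ →₀ (Fin T → ℂ)) :=
    { carrier := {p | ∃ φ : ℕ → SimpleFunc ℝ (Fin T → ℂ),
        Tendsto (fun n => ∫ x, quadForm f (fun x => trigPoly p x - φ n x) x ∂freq) atTop (𝓝 0) ∧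
        Tendsto (fun n => simpleIntegralLp hZ.memLp (φ n)) atTop (𝓝 (seqLp hξ p))}
      zero_mem' := by
        refine ⟨fun _ => 0, ?_, ?_⟩
        · simp [trigPoly_zero, quadForm]
        · have : simpleIntegralLp hZ.memLp 0 = 0 := by
            have := simpleIntegralLp_sub hZ 0 0
            rwa [sub_self, sub_self] at this
          simp only [this, map_zero]
          exact tendsto_const_nhds
      add_mem' := by
        rintro p q ⟨φ, h1, h2⟩ ⟨ψ, h3, h4⟩
        refine ⟨fun n => φ n + ψ n, ?_, ?_⟩
        · refine squeeze_zero (fun n => integral_quadForm_nonneg hf _) (fun n => ?_)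
            (by simpa using (h1.const_mul 2).add (h3.const_mul 2))
          have hb := (memL2_trigPoly hf p).sub hf (memL2_simpleFunc hf (φ n))
          have hd := (memL2_trigPoly hf q).sub hf (memL2_simpleFunc hf (ψ n))
          rw [← integral_const_mul, ← integral_const_mul,
            ← integral_add (hb.2.const_mul 2) (hd.2.const_mul 2)]
          have hbd : MemL2 f fun x => trigPoly (p + q) x - (φ n + ψ n) x :=
            (memL2_trigPoly hf _).sub hf (memL2_simpleFunc hf _)
          refine integral_mono_ae hbd.2 ((hb.2.const_mul 2).add (hd.2.const_mul 2)) ?_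
          filter_upwards [hf.posSemidef] with x hx
          simp only [quadForm_eq, trigPoly_add, SimpleFunc.coe_add, Pi.add_apply]
          rw [add_sub_add_comm]
          exact sform_self_add_le hx _ _
        · simp only [simpleIntegralLp_add hZ, map_add]
          exact h2.add h4
      smul_mem' := by
        rintro c p ⟨φ, h1, h2⟩
        refine ⟨fun n => c • φ n, ?_, ?_⟩
        · have h3 := h1.const_mul (‖c‖ ^ 2)
          rw [mul_zero] at h3
          refine h3.congr fun n => ?_
          rw [← integral_const_mul]
          congr 1; ext x
          simp only [quadForm_eq, trigPoly_smul, SimpleFunc.coe_smul, Pi.smul_apply, ← smul_sub,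
            sform_smul_left, sform_smul_right]
          rw [← mul_assoc, mul_comm (conj c), Complex.mul_conj, Complex.re_ofReal_mul, Complex.normSq_eq_norm_sq]
        · simp only [simpleIntegralLp_smul hZ, map_smul]
          exact h2.const_smul c }
  have hgen : ∀ j ν, Finsupp.single j (Pi.single ν (1 : ℂ)) ∈ V := by
    intro j ν
    obtain ⟨-, -, φ, h1, h2⟩ := hZ.representation j ν
    refine ⟨φ, ?_, ?_⟩
    · refine h1.congr fun n => ?_
      have h3 : ∀ x, trigPoly (Finsupp.single j (Pi.single ν (1 : ℂ))) x =
          Pi.single ν (expo j x) := fun x => by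
        ext μ
        simp [trigPoly_single, Pi.single_apply]
      simp only [h3]
    · rw [tendsto_iff_edist_tendsto_0]
      refine h2.congr fun n => ?_
      rw [seqLp_single_single, edist_comm, Lp.edist_def]
      refine eLpNorm_congr_ae ?_
      filter_upwards [(hξ j ν).coeFn_toLp, coeFn_simpleIntegralLp (hm := hZ.memLp) (φ n)]
        with ω h3 h4
      rw [Pi.sub_apply, h3, h4]
  have hp : p ∈ V := by
    rw [← Finsupp.sum_single p]
    refine Submodule.sum_mem _ fun j _ => ?_
    have h1 : Finsupp.single j (p j) =
        ∑ ν, p j ν • Finsupp.single j (Pi.single ν (1 : ℂ)) := by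
      simp only [Finsupp.smul_single, ← Finsupp.single_finsetSum]
      congr 1
      ext μ
      simp [Finset.sum_apply, Pi.single_apply]
    rw [h1]
    exact Submodule.sum_mem _ fun ν _ => Submodule.smul_mem _ _ (hgen j ν)
  exact hp

/-- An element of `L₂(f + g)` that is approximated by trigonometric polynomials integrates to the
limit of the corresponding linear functionals. -/
theorem isStochasticIntegral_of_approx {η : ℤ → Ω → Fin T → ℂ}
    {g : ℝ → Matrix (Fin T) (Fin T) ℂ} {Zξ Zη : Set ℝ → Ω → Fin T → ℂ}
    (hZξ : IsRandomSpectralMeasure P ξ f Zξ) (hZη : IsRandomSpectralMeasure P η g Zη)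
    (hf : IsWeight f) (hg : IsWeight g) (hξ : ∀ n ν, MemLp (fun ω => ξ n ω ν) 2 P)
    (hη : ∀ n ν, MemLp (fun ω => η n ω ν) 2 P) {h : ℝ → Fin T → ℂ}
    (hh : MemL2 (fun x => f x + g x) h) {X : Lp ℂ 2 P}
    (happ : ∀ ε : ℝ, 0 < ε → ∃ p : ℤ →₀ (Fin T → ℂ),
      ∫ x, quadForm (fun x => f x + g x) (fun x => h x - trigPoly p x) x ∂freq < ε ∧
      ‖X - (seqLp hξ p + seqLp hη p)‖ < ε) :
    IsStochasticIntegral P (fun x => f x + g x) (fun Δ ω => Zξ Δ ω + Zη Δ ω) h X := by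
  have hF := hf.add hg
  have hex : ∀ n : ℕ, ∃ φ : SimpleFunc ℝ (Fin T → ℂ),
      ∫ x, quadForm (fun x => f x + g x) (fun x => h x - φ x) x ∂freq < 1 / ((n : ℝ) + 1) ∧
      ‖X - (simpleIntegralLp hZξ.memLp φ + simpleIntegralLp hZη.memLp φ)‖ <
        1 / ((n : ℝ) + 1) := by
    intro n
    set ε : ℝ := 1 / ((n : ℝ) + 1)
    have hε : 0 < ε := by positivity
    -- `ε / 4` twice, each doubled by `integral_quadForm_sub_le`, adds up to `ε`.
    obtain ⟨p, hp1, hp2⟩ := happ (ε / 4) (by positivity)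
    obtain ⟨φ, hφ⟩ := exists_tendsto_simpleFunc (continuous_trigPoly p)
      (C := ∑ j ∈ p.support, ‖p j‖) fun x => (pi_norm_le_iff_of_nonneg
        (Finset.sum_nonneg fun _ _ => norm_nonneg _)).2 (norm_trigPoly_apply_le p x)
    -- The sequences provided for `ξ` and for `η` may differ; the isometry transfers both limits to
    -- the common sequence `φ`.
    have hlim : ∀ {ζ : ℤ → Ω → Fin T → ℂ} {w : ℝ → Matrix (Fin T) (Fin T) ℂ}
        {Z : Set ℝ → Ω → Fin T → ℂ} (hZ : IsRandomSpectralMeasure P ζ w Z) (_ : IsWeight w)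
        (hζ : ∀ n ν, MemLp (fun ω => ζ n ω ν) 2 P),
        Tendsto (fun n => simpleIntegralLp hZ.memLp (φ n)) atTop (𝓝 (seqLp hζ p)) := by
      intro ζ w Z hZ hw hζ
      obtain ⟨ψ, hψ1, hψ2⟩ := exists_tendsto_simpleIntegralLp hZ hw hζ p
      exact tendsto_simpleIntegralLp_of_tendsto hZ hw (memL2_trigPoly hw p) hψ1 (hφ w hw) hψ2
    have hsum := ((hlim hZξ hf hξ).add (hlim hZη hg hη)).const_sub X
    have hev := (hsum.norm.eventually_lt_const (u := ε) (by linarith)).and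
      ((hφ _ hF).eventually_lt_const (u := ε / 4) (by positivity))
    obtain ⟨k, hk1, hk2⟩ := hev.exists
    refine ⟨φ k, ?_, hk1⟩
    have h1 := integral_quadForm_sub_le hF (hh.sub hF (memL2_trigPoly hF p))
      ((memL2_simpleFunc hF (φ k)).sub hF (memL2_trigPoly hF p))
    have h2 : ∫ x, quadForm (fun x => f x + g x) (fun x => φ k x - trigPoly p x) x ∂freq =
        ∫ x, quadForm (fun x => f x + g x) (fun x => trigPoly p x - φ k x) x ∂freq := by
      congr 1; ext x
      simp only [quadForm_eq, sform_sub_left, sform_sub_right]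
      congr 1
      ring
    simp only [sub_sub_sub_cancel_right] at h1
    rw [h2] at h1
    linarith
  choose φ hφ1 hφ2 using hex
  refine ⟨hh, Lp.memLp X, φ, ?_, ?_⟩
  · exact squeeze_zero (fun n => integral_quadForm_nonneg hF _) (fun n => (hφ1 n).le)
      tendsto_one_div_add_atTop_nhds_zero_nat
  · have h1 : Tendsto (fun n => simpleIntegralLp hZξ.memLp (φ n) +
        simpleIntegralLp hZη.memLp (φ n)) atTop (𝓝 X) := by
      rw [tendsto_iff_norm_sub_tendsto_zero]
      refine squeeze_zero (fun n => norm_nonneg _) (fun n => ?_)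
        tendsto_one_div_add_atTop_nhds_zero_nat
      rw [norm_sub_rev]
      exact (hφ2 n).le
    rw [tendsto_iff_edist_tendsto_0] at h1
    refine h1.congr fun n => ?_
    rw [edist_comm, Lp.edist_def]
    refine eLpNorm_congr_ae ?_
    filter_upwards [Lp.coeFn_add (simpleIntegralLp hZξ.memLp (φ n))
      (simpleIntegralLp hZη.memLp (φ n)), coeFn_simpleIntegralLp (hm := hZξ.memLp) (φ n),
      coeFn_simpleIntegralLp (hm := hZη.memLp) (φ n)] with ω h3 h4 h5
    rw [Pi.sub_apply, h3, Pi.add_apply, h4, h5]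
    simp only [simpleIntegral, Pi.add_apply, mul_add, Finset.sum_add_distrib]

end StochasticIntegral

/-- A function at zero distance from the spectral characteristic agrees with it almost
everywhere. -/
theorem ae_eq_of_integral_quadForm_sub {T : ℕ} {F : ℝ → Matrix (Fin T) (Fin T) ℂ}
    (hF : IsWeight F) (hu : ∀ᵐ x ∂freq, IsUnit (F x).det) {b d : ℝ → Fin T → ℂ}
    (hb : MemL2 F b) (hd : MemL2 F d)
    (h : ∫ x, quadForm F (fun x => b x - d x) x ∂freq ≤ 0) : b =ᵐ[freq] d := by
  have h0 := le_antisymm h (integral_quadForm_nonneg hF _)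
  rw [integral_eq_zero_iff_of_nonneg_ae (quadForm_nonneg hF _) (hb.sub hF hd).2] at h0
  filter_upwards [h0, hF.posSemidef, hu] with x hx1 hx2 hx3
  by_contra hne
  have h4 := (posDef_of_isUnit_det hx2 hx3).dotProduct_mulVec_pos
    (star_ne_zero.2 (sub_ne_zero.2 hne))
  rw [star_star] at h4
  have h5 := (Complex.lt_def.1 h4).1
  rw [quadForm_eq, sform] at hx1
  rw [hx1] at h5
  exact lt_irrefl _ h5

end Interp

/-! ### The interpolation theorem -/

open Interp in
theorem mainTheorem1 {Ω : Type*} [MeasurableSpace Ω] (P : Measure Ω) [IsProbabilityMeasure P]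
    (T s : ℕ) (N K : ℕ → ℕ) (hN : N 0 = 0) (hK : K 0 = 0)
    (ξ η : ℤ → Ω → Fin T → ℂ) (f g : ℝ → Matrix (Fin T) (Fin T) ℂ) (a : ℤ → Fin T → ℂ)
    (hξ : IsStationary P ξ) (hη : IsStationary P η) (hξη : Uncorrelated P ξ η)
    (hf : IsSpectralDensity P ξ f) (hg : IsSpectralDensity P η g)
    (hmin : Minimality (fun x => f x + g x)) :
    -- the integrals that define the block matrices converge, and `B_s` is invertible
    ((∀ ν μ, Integrable (fun x => symbolB f g x ν μ) freq) ∧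
      (∀ ν μ, Integrable (fun x => symbolD f g x ν μ) freq) ∧
      (∀ ν μ, Integrable (fun x => symbolR f g x ν μ) freq) ∧
      IsUnit (blockToeplitz N K s (symbolB f g))) ∧
    -- the two forms of the spectral characteristic agree
    (∀ᵐ x ∂freq, optChar N K s f g a x =
      vecPoly N K s (coeffVec N K s a) x -
        Matrix.vecMul
          (Matrix.vecMul (vecPoly N K s (coeffVec N K s a) x) (g x)
            + vecPoly N K s (solVec N K s f g a) x)
          (f x + g x)⁻¹) ∧
    -- it is the unique minimizer of the mean square error functional, with the stated minimum
    IsOptimalCharacteristic f g (missing N K s) (vecPoly N K s (coeffVec N K s a))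
      (optChar N K s f g a) ∧
    (∀ h, IsOptimalCharacteristic f g (missing N K s) (vecPoly N K s (coeffVec N K s a)) h →
      h =ᵐ[freq] optChar N K s f g a) ∧
    ((spectralMSE f g (vecPoly N K s (coeffVec N K s a)) (optChar N K s f g a) : ℝ) : ℂ) =
      errorValue N K s f g a ∧
    -- the optimal linear estimate exists, is unique, has the stated mean square error, and is
    -- given by the spectral characteristic
    ∃ X : Lp ℂ 2 P,
      IsOptimalLinearEstimate P (fun j ω => ξ j ω + η j ω) (missing N K s)
        (functional N K s a ξ) X ∧
      (∀ Y : Lp ℂ 2 P, IsOptimalLinearEstimate P (fun j ω => ξ j ω + η j ω) (missing N K s)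
        (functional N K s a ξ) Y → Y = X) ∧
      ((∫ ω, ‖functional N K s a ξ ω - X ω‖ ^ 2 ∂P : ℝ) : ℂ) = errorValue N K s f g a ∧
      ∀ Zξ Zη : Set ℝ → Ω → Fin T → ℂ,
        IsRandomSpectralMeasure P ξ f Zξ → IsRandomSpectralMeasure P η g Zη →
        IsStochasticIntegral P (fun x => f x + g x) (fun Δ ω => Zξ Δ ω + Zη Δ ω)
          (optChar N K s f g a) X := by
  have hwf := hf.isWeight
  have hwg := hg.isWeight
  have hF := hwf.add hwg
  have hG := hF.inv hmin
  have hpi : (0 : ℝ) < 1 / (2 * Real.pi) := by positivity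
  have hopt := memL2Minus_optChar (N := N) (K := K) (s := s) a hwf hwg hmin
  have hval := spectralMSE_optChar (N := N) (K := K) (s := s) a hwf hwg hmin
  refine ⟨⟨hG.integrable, integrable_mul_inv hwf hwg hmin, hwf.mul_inv_mul hwg hmin,
    isUnit_blockToeplitz hG (hmin.1.mono fun x hx => Matrix.isUnit_nonsing_inv_det _ hx)⟩,
    hmin.1.mono fun x hx => optChar_eq a hx, ⟨hopt, fun d hd => ?_⟩, fun d hd => ?_, hval, ?_⟩
  · rw [spectralMSE_eq_add a hwf hwg hmin hd]
    exact le_add_of_nonneg_right (mul_nonneg hpi.le (integral_quadForm_nonneg hF _))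
  · have h1 := hd.2 _ hopt
    rw [spectralMSE_eq_add a hwf hwg hmin hd.1] at h1
    exact ae_eq_of_integral_quadForm_sub hF hmin.1 hd.1.1 hopt.1
      (nonpos_of_mul_nonpos_right (by linarith) hpi)
  · have hζ : ∀ n ν, MemLp (fun ω => (ξ n ω + η n ω) ν) 2 P :=
      fun n ν => (hξ.memLp n ν).add (hη.memLp n ν)
    obtain ⟨X, hX, hpyth, hmse, hdist⟩ :=
      exists_projection a hξ.memLp hη.memLp hf hg hξη hζ hmin
    have hA := seqLp_functionalCoeff (N := N) (K := K) (s := s) a hξ.memLp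
    have hint : ∀ Y : Lp ℂ 2 P, ∫ ω, ‖functional N K s a ξ ω - Y ω‖ ^ 2 ∂P =
        ‖seqLp hξ.memLp (functionalCoeff N K s a) - Y‖ ^ 2 := fun Y =>
      norm_sq_eq_integral _ ((hA.sub (EventuallyEq.refl _ _)).trans (Lp.coeFn_sub _ _).symm)
    refine ⟨X, ⟨hX, fun Y hY => ?_⟩, fun Y hY => ?_, ?_, fun Zξ Zη hZξ hZη => ?_⟩
    · rw [hint, hint, hpyth Y hY]
      exact le_add_of_nonneg_right (sq_nonneg _)
    · have h1 := hY.2 X hX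
      rw [hint, hint, hpyth Y hY.1] at h1
      have h2 : ‖X - Y‖ ^ 2 = 0 := le_antisymm (by linarith) (sq_nonneg _)
      exact (sub_eq_zero.1 (norm_eq_zero.1 (pow_eq_zero_iff two_ne_zero |>.1 h2))).symm
    · rw [hint, hmse, hval]
    · refine isStochasticIntegral_of_approx hZξ hZη hwf hwg hξ.memLp hη.memLp hopt.1
        fun ε hε => ?_
      -- The first bound is for the distance in `L₂(f + g)`; the second makes the squared distance
      -- to `X`, which carries the factor `1/(2π)`, less than `ε ^ 2`.
      obtain ⟨p, hp, hpε⟩ := hopt.2 (min ε (2 * Real.pi * ε ^ 2)) (by positivity)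
      refine ⟨p, hpε.trans_le (min_le_left _ _), ?_⟩
      rw [← seqLp_add_seqLp hζ]
      refine lt_of_pow_lt_pow_left₀ 2 hε.le ?_
      rw [hdist p hp, one_div_mul_eq_div, div_lt_iff₀ (by positivity), mul_comm (ε ^ 2)]
      refine lt_of_eq_of_lt ?_ (hpε.trans_le (min_le_right _ _))
      congr 1; ext x
      simp only [quadForm_eq, sform_sub_left, sform_sub_right]
      congr 1
      ring
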